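/- An instance of TJ-Independent Set Reconfiguration is $\mathcal A=(G,I_{\sf init},I_{\sf fin},k)$ with $G=(V,E)$ a finite simple graph and $I_{\sf init},I_{\sf fin}$ independent sets of $G$ of size $k$. A reconfiguration sequence of length $\ell$ is a sequence $I_{\sf init}=I_0,I_1,\dots,I_\ell=I_{\sf fin}$ of independent sets in which each $I_{i+1}$ arises from $I_i$ by a jump, that is, $I_{i+1}=(I_i\setminus\{u\})\cup\{v\}$ with $u\in I_i$ and $v\notin I_i$. In an instance of Partitioned TJ-Independent Set Reconfiguration there is moreover a partition of $V$ into token sets $P_1,\dots,P_k$, each of which contains exactly one vertex of $I_{\sf init}$ and exactly one vertex of $I_{\sf fin}$, and a token may only jump within its token set ($u$ and $v$ lie in the same $P_j$). In both problems the parameter is $k$ and the question is whether a reconfiguration sequence (of any length) exists. Instances are encoded as bit strings by $n=|V|$ and $k$ in unary, the adjacency matrix, the characteristic vectors of $I_{\sf init}$ and $I_{\sf fin}$ and, in the partitioned case, the $n\times k$ membership matrix of the token sets. A pl-reduction (parameterized logspace reduction) from one parameterized problem to another is a map $f$ from the instances of the first to the instances of the second such that $\mathcal A$ is a yes-instance if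 and only if $f(\mathcal A)$ is one, and such that, for some computable function $g$, the parameter of $f(\mathcal A)$ is at most $g(k)$ and $f$ is computed by a deterministic Turing machine (with read-only input tape, finitely many work tapes and write-only output tape) in space $\mathcal O(g(k)+\log N)$, where $k$ is the parameter of $\mathcal A$ and $N$ is the number of bits of its encoding. **Lemma.** There exists a pl-reduction $f$ from Partitioned TJ-Independent Set Reconfiguration to TJ-Independent Set Reconfiguration such that for every instance $\mathcal A$ of Partitioned TJ-Independent Set Reconfiguration and every integer $\ell\ge 0$: 1. if $\mathcal A$ admits a reconfiguration sequence of length $\ell$, then $f(\mathcal A)$ admits a reconfiguration sequence of length $3\ell$; 2. $\mathcal A$ admits a reconfiguration sequence of length at most $\ell$ if and only if $f(\mathcal A)$ admits a reconfiguration sequence of length at most $3\ell$. -/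

import Mathlib

/-! ### Space-bounded computation -/

/-- What the head on the read-only input tape sees: one of the two end markers or an input bit. -/
inductive InSym where
  | leftEnd
  | bit (b : Bool)
  | rightEnd

/-- A head stays, moves one cell to the left or one cell to the right. -/
inductive HeadMove where
  | stay
  | left
  | right

/-- New position on a tape that is infinite to the right, with leftmost cell `0`. -/
def HeadMove.apply : HeadMove → ℕ → ℕ
  | .stay, p => p
  | .left, p => p - 1
  | .right, p => p + 1

/-- A deterministic Turing machine with a two-way read-only input tape, finitely many read-write
work tapes and a write-only output tape, over the input and output alphabet `Bool`. In one step
the machine reads the input symbol and the work symbols below its heads; it then halts (`none`),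
or it changes its state, moves the input head, rewrites and moves on each work tape, and appends
a word to the output. -/
structure Transducer where
  State : Type
  WorkSym : Type
  WorkTape : Type
  finite_state : Finite State
  finite_workSym : Finite WorkSym
  finite_workTape : Finite WorkTape
  start : State
  blank : WorkSym
  trans : State → InSym → (WorkTape → WorkSym) →
    Option (State × HeadMove × (WorkTape → WorkSym × HeadMove) × List Bool)

namespace Transducer

/-- A configuration. Input position `0` carries the left end marker, position `i + 1` the `i`-th
input bit, and position `length + 1` the right end marker. -/
structure Config (M : Transducer) where
  state : M.State
  inHead : ℕ
  work : M.WorkTape → ℕ → M.WorkSym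
  head : M.WorkTape → ℕ
  out : List Bool

variable (M : Transducer)

/-- All work tapes are blank, all heads are at the left end, nothing has been written. -/
def initial : M.Config where
  state := M.start
  inHead := 0
  work := fun _ _ => M.blank
  head := fun _ => 0
  out := []

/-- The symbol at a position of the input tape that carries `x`. -/
def readInput (x : List Bool) : ℕ → InSym
  | 0 => .leftEnd
  | i + 1 => match x[i]? with
    | some b => .bit b
    | none => .rightEnd

/-- One step on input `x`; `none` if the machine halts. The input head never leaves the part
between (and including) the two end markers. -/
def step (x : List Bool) (c : M.Config) : Option M.Config :=
  (M.trans c.state (readInput x c.inHead) (fun t => c.work t (c.head t))).map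
    fun (q, mv, act, w) =>
      { state := q
        inHead := min (mv.apply c.inHead) (x.length + 1)
        work := fun t j => if j = c.head t then (act t).1 else c.work t j
        head := fun t => (act t).2.apply (c.head t)
        out := c.out ++ w }

/-- The configurations that the machine goes through on input `x`. -/
def Reachable (x : List Bool) (c : M.Config) : Prop :=
  Relation.ReflTransGen (fun c₁ c₂ => M.step x c₁ = some c₂) M.initial c

/-- On input `x`, the machine halts with `y` on its output tape. -/
def Outputs (x y : List Bool) : Prop :=
  ∃ c, M.Reachable x c ∧ M.step x c = none ∧ c.out = y

/-- On input `x`, the machine visits only the first `s` cells of each of its work tapes. (The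
number of tapes is fixed by the machine, so this is the number of visited work cells up to a
constant factor.) -/
def RunsInSpace (x : List Bool) (s : ℕ) : Prop :=
  ∀ c, M.Reachable x c → ∀ t, c.head t < s

end Transducer

/-! ### Parameterized problems and parameterized logspace reductions -/

/-- A parameterized decision problem: its instances, the encoding of instances as bit strings,
the parameter of an instance, and which instances are yes-instances. -/
structure ParamProblem where
  Inst : Type
  encode : Inst → List Bool
  param : Inst → ℕ
  yes : Inst → Prop

/-- `f` is a parameterized logspace reduction (pl-reduction) from `P` to `Q`: it maps
yes-instances, and only those, to yes-instances; the new parameter is bounded by a computable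
function `g` of the old one; and some machine computes `f` in space `O(g(k) + log N)`, where `k`
is the parameter and `N` the number of bits of the input. -/
def IsPLReduction (P Q : ParamProblem) (f : P.Inst → Q.Inst) : Prop :=
  (∀ x, P.yes x ↔ Q.yes (f x)) ∧
  ∃ g : ℕ → ℕ, Computable g ∧
    (∀ x, Q.param (f x) ≤ g (P.param x)) ∧
    ∃ (M : Transducer) (C : ℕ), ∀ x,
      M.Outputs (P.encode x) (Q.encode (f x)) ∧
      M.RunsInSpace (P.encode x) (C * (g (P.param x) + Nat.log 2 (P.encode x).length))

/-! ### Independent set reconfiguration -/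

/-- An instance of independent set reconfiguration: a finite graph, a number `k` of tokens, and
two independent sets of size `k`. -/
structure ISRInstance where
  n : ℕ
  G : SimpleGraph (Fin n)
  k : ℕ
  init : Finset (Fin n)
  target : Finset (Fin n)
  init_indep : G.IsIndepSet (init : Set (Fin n))
  target_indep : G.IsIndepSet (target : Set (Fin n))
  init_card : init.card = k
  target_card : target.card = k

/-- An instance of the partitioned version: moreover the vertex set is partitioned into `k` token
sets (`part v` is the index of the token set of `v`), and both given independent sets have exactly
one vertex in each token set. -/
structure PartitionedISRInstance extends ISRInstance where
  part : Fin n → Fin k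
  init_part : ∀ i, ∃! v, v ∈ init ∧ part v = i
  target_part : ∀ i, ∃! v, v ∈ target ∧ part v = i

/-- Token jumping: `J` arises from `I` by moving the token on `u` to the empty vertex `v`. -/
def IsJump {V : Type} [DecidableEq V] (I J : Finset V) (u v : V) : Prop :=
  u ∈ I ∧ v ∉ I ∧ J = insert v (I.erase u)

/-- A reconfiguration sequence `S 0, …, S ℓ` of length `ℓ` (that is, with `ℓ` jumps) under the
token jumping rule. -/
def ISRInstance.HasSequence (A : ISRInstance) (ℓ : ℕ) : Prop :=
  ∃ S : ℕ → Finset (Fin A.n),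
    S 0 = A.init ∧ S ℓ = A.target ∧
    (∀ i ≤ ℓ, A.G.IsIndepSet (S i : Set (Fin A.n))) ∧
    (∀ i < ℓ, ∃ u v, IsJump (S i) (S (i + 1)) u v)

/-- A reconfiguration sequence of length `ℓ` under the partitioned token jumping rule: a token
only jumps within its token set. -/
def PartitionedISRInstance.HasSequence (A : PartitionedISRInstance) (ℓ : ℕ) : Prop :=
  ∃ S : ℕ → Finset (Fin A.n),
    S 0 = A.init ∧ S ℓ = A.target ∧
    (∀ i ≤ ℓ, A.G.IsIndepSet (S i : Set (Fin A.n))) ∧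
    (∀ i < ℓ, ∃ u v, IsJump (S i) (S (i + 1)) u v ∧ A.part u = A.part v)

open Classical in
/-- The encoding of an instance as a bit string: `n` and `k` in unary, the adjacency matrix, and
the characteristic vectors of the two independent sets. -/
noncomputable def ISRInstance.encode (A : ISRInstance) : List Bool :=
  List.replicate A.n true ++ [false] ++ List.replicate A.k true ++ [false] ++
  ((List.finRange A.n).flatMap fun u => (List.finRange A.n).map fun v => decide (A.G.Adj u v)) ++
  ((List.finRange A.n).map fun v => decide (v ∈ A.init)) ++
  ((List.finRange A.n).map fun v => decide (v ∈ A.target))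

/-- In the partitioned version, the `n × k` membership matrix of the token sets follows. -/
noncomputable def PartitionedISRInstance.encode (A : PartitionedISRInstance) : List Bool :=
  A.toISRInstance.encode ++
  ((List.finRange A.n).flatMap fun v => (List.finRange A.k).map fun i => decide (A.part v = i))

/-- TJ-Independent Set Reconfiguration, parameterized by the number of tokens. -/
noncomputable def tjISR : ParamProblem where
  Inst := ISRInstance
  encode := ISRInstance.encode
  param := ISRInstance.k
  yes A := ∃ ℓ, A.HasSequence ℓ

/-- Partitioned TJ-Independent Set Reconfiguration, parameterized by the number of tokens. -/
noncomputable def partitionedTJISR : ParamProblem where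
  Inst := PartitionedISRInstance
  encode := PartitionedISRInstance.encode
  param A := A.k
  yes A := ∃ ℓ, A.HasSequence ℓ

/-! The map `triple` turns every token set into a clique and takes three disjoint copies of the
result. Its vertex set is covered by `3k` cliques and there are `3k` tokens, so an independent set
of that size has exactly one vertex in each clique: it is a triple of transversals of the original
instance (`isTransversal_slice`). A jump vacates one clique, which has to be occupied again, so it
is a move within one token set of one copy (`move_slice`). A sequence of `m` jumps therefore splits
into three sequences for the original instance of total length `m` (`steps_slice`), and the shortest
has length at most `m / 3`. Conversely, running a given sequence in one copy after the other triples
its length (`HasSequence.triple`). The cliques alone enforce the partition; the three copies only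
serve to obtain the factor `3`.

For the space bound a concrete program is built from fragments and verified compositionally. It has
seven registers, and a cell of its only work tape holds one binary digit of each. It counts `n` and
`k` from their unary codes, then computes every output bit afresh: to read an input bit, it rewinds
the head and walks right, with nested counting loops in place of multiplication. The common number
`L` of digits grows only when `n` or `k` is being counted, which gives `2 ^ L ≤ 2 * N` for input
length `N` (`exec_scan`), hence logarithmic space. -/

/-! ### Machine fragments with one work tape -/

/-- Symbols of the work tape: an end marker, or one binary digit for each register. -/
inductive TapeSym (R : Type) where
  | blank
  | wall
  | digit (d : R → Bool)

instance {R : Type} [Finite R] : Finite (TapeSym R) :=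
  Finite.of_surjective
    (fun o : Option (Option (R → Bool)) => match o with
      | none => .blank
      | some none => .wall
      | some (some d) => .digit d)
    (by
      rintro (_ | _ | d)
      exacts [⟨none, rfl⟩, ⟨some none, rfl⟩, ⟨some (some d), rfl⟩])

/-- A piece of a machine with one work tape, with exits labelled by `E`. -/
structure Frag (R E : Type) where
  State : Type
  finite_state : Finite State
  entry : State
  trans : State → InSym → TapeSym R → (State ⊕ E) × HeadMove × TapeSym R × HeadMove × List Bool

/-- A configuration of a fragment, without the state. -/
structure Conf (R : Type) where
  inHead : ℕ
  tape : ℕ → TapeSym R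
  head : ℕ
  out : List Bool

namespace Frag

variable {R E E' : Type}

/-- One step of a fragment on input `x`. -/
def step (F : Frag R E) (x : List Bool) (q : F.State) (c : Conf R) : (F.State ⊕ E) × Conf R :=
  let t := F.trans q (Transducer.readInput x c.inHead) (c.tape c.head)
  (t.1,
    { inHead := min (t.2.1.apply c.inHead) (x.length + 1)
      tape := Function.update c.tape c.head t.2.2.1
      head := t.2.2.2.1.apply c.head
      out := c.out ++ t.2.2.2.2 })

/-- Started in state `q`, the fragment leaves through exit `e`, visiting only the first `s`
cells of the work tape. -/
inductive Run (F : Frag R E) (x : List Bool) (s : ℕ) : F.State → Conf R → E → Conf R → Prop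
  | done {q c e c'} : c.head < s → F.step x q c = (.inr e, c') → Run F x s q c e c'
  | next {q c q' c₁ e c'} : c.head < s → F.step x q c = (.inl q', c₁) → Run F x s q' c₁ e c' →
      Run F x s q c e c'

/-- A complete run of a fragment. -/
def Exec (F : Frag R E) (x : List Bool) (s : ℕ) (c : Conf R) (e : E) (c' : Conf R) : Prop :=
  F.Run x s F.entry c e c'

/-- Sequential composition. -/
def bind [Finite E] (F : Frag R E) (G : E → Frag R E') : Frag R E' where
  State := F.State ⊕ Σ e, (G e).State
  finite_state :=
    have := F.finite_state
    have := fun e => (G e).finite_state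
    inferInstance
  entry := .inl F.entry
  trans
    | .inl q, a, t =>
      let r := F.trans q a t
      (.inl (match r.1 with
        | .inl q' => .inl q'
        | .inr e => .inr ⟨e, (G e).entry⟩), r.2)
    | .inr ⟨e, q⟩, a, t =>
      let r := (G e).trans q a t
      (match r.1 with
        | .inl q' => .inl (.inr ⟨e, q'⟩)
        | .inr e' => .inr e', r.2)

/-- Repetition until the body returns a value. -/
def loop (F : Frag R (Option E)) : Frag R E where
  State := F.State
  finite_state := F.finite_state
  entry := F.entry
  trans q a t :=
    let r := F.trans q a t
    (match r.1 with
      | .inl q' => .inl q'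
      | .inr none => .inl F.entry
      | .inr (some e) => .inr e, r.2)

/-- A single step that does not touch the work tape. -/
def act (f : InSym → E × HeadMove × List Bool) : Frag R E where
  State := Unit
  finite_state := inferInstance
  entry := ()
  trans _ a t := (.inr (f a).1, (f a).2.1, t, .stay, (f a).2.2)

/-- Return a value. -/
def ret (e : E) : Frag R E := act fun _ => (e, .stay, [])

/-- Write the end marker below the head. -/
def putWall : Frag R Unit where
  State := Unit
  finite_state := inferInstance
  entry := ()
  trans _ _ _ := (.inr (), .stay, .wall, .stay, [])

/-- Pass over all digits from left to right with a finite automaton that may rewrite them, possibly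
append a new digit, and return to the end marker. The exit is the last state of the automaton. -/
def sweep {S : Type} [Finite S] (s₀ : S) (δ : S → (R → Bool) → S × (R → Bool))
    (fin : S → Option (R → Bool)) : Frag R S where
  State := Option (S ⊕ S)
  finite_state := inferInstance
  entry := none
  trans
    | none, _, t => (.inl (some (.inl s₀)), .stay, t, .right, [])
    | some (.inl s), _, .digit d =>
      (.inl (some (.inl (δ s d).1)), .stay, .digit (δ s d).2, .right, [])
    | some (.inl s), _, t =>
      (.inl (some (.inr s)), .stay, match fin s with
        | none => t
        | some d => .digit d, .left, [])
    | some (.inr s), _, .wall => (.inr s, .stay, .wall, .stay, [])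
    | some (.inr s), _, t => (.inl (some (.inr s)), .stay, t, .left, [])

variable {x : List Bool} {s : ℕ} {c c₁ c' : Conf R}

theorem exec_bind [Finite E] {F : Frag R E} {G : E → Frag R E'} {e : E} {e' : E'}
    (hF : F.Exec x s c e c₁) (hG : (G e).Exec x s c₁ e' c') : (F.bind G).Exec x s c e' c' := by
  have hright : ∀ {q c e' c'}, (G e).Run x s q c e' c' →
      (F.bind G).Run x s (.inr ⟨e, q⟩) c e' c' := by
    intro q c e' c' h
    induction h with
    | done hs h =>
      refine .done hs ?_
      simp only [step, Prod.mk.injEq] at h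
      simp [step, bind, h.1, ← h.2]
    | next hs h _ ih =>
      refine .next hs ?_ ih
      simp only [step, Prod.mk.injEq] at h
      simp [step, bind, h.1, ← h.2]
  have hleft : ∀ {q c e₁ c₁}, F.Run x s q c e₁ c₁ → e₁ = e → (G e).Run x s (G e).entry c₁ e' c' →
      (F.bind G).Run x s (.inl q) c e' c' := by
    intro q c e₁ c₁ h
    induction h with
    | done hs h =>
      rintro rfl h'
      refine .next hs ?_ (hright h')
      simp only [step, Prod.mk.injEq] at h
      simp [step, bind, h.1, ← h.2]
    | next hs h _ ih =>
      intro he h'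
      refine .next hs ?_ (ih he h')
      simp only [step, Prod.mk.injEq] at h
      simp [step, bind, h.1, ← h.2]
  exact hleft hF rfl hG

theorem exec_loop_some {F : Frag R (Option E)} {e : E} (h : F.Exec x s c (some e) c') :
    F.loop.Exec x s c e c' := by
  have : ∀ {q c o c'}, F.Run x s q c o c' → o = some e → F.loop.Run x s q c e c' := by
    intro q c o c' h
    induction h with
    | done hs h =>
      rintro rfl
      refine .done hs ?_
      simp only [step, Prod.mk.injEq] at h
      simp [step, loop, h.1, ← h.2]
    | next hs h _ ih =>
      intro he
      refine .next hs ?_ (ih he)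
      simp only [step, Prod.mk.injEq] at h
      simp [step, loop, h.1, ← h.2]
  exact this h rfl

/-- `Run` is inductive, so `Exec` includes termination. Loops are verified by unrolling: this lemma
peels off one pass, and `exec_loop_some` closes the last one. -/
theorem exec_loop_none {F : Frag R (Option E)} {e : E} (h : F.Exec x s c none c₁)
    (h' : F.loop.Exec x s c₁ e c') : F.loop.Exec x s c e c' := by
  have : ∀ {q c o c₁}, F.Run x s q c o c₁ → o = none → F.loop.Exec x s c₁ e c' →
      F.loop.Run x s q c e c' := by
    intro q c o c₁ h
    induction h with
    | done hs h =>
      rintro rfl h'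
      refine .next hs ?_ h'
      simp only [step, Prod.mk.injEq] at h
      simp [step, loop, h.1, ← h.2]
    | next hs h _ ih =>
      intro he h'
      refine .next hs ?_ (ih he h')
      simp only [step, Prod.mk.injEq] at h
      simp [step, loop, h.1, ← h.2]
  exact this h rfl h'

theorem exec_act (f : InSym → E × HeadMove × List Bool) (hs : c.head < s) :
    (act f).Exec x s c (f (Transducer.readInput x c.inHead)).1
      { c with
        inHead := min ((f (Transducer.readInput x c.inHead)).2.1.apply c.inHead) (x.length + 1)
        out := c.out ++ (f (Transducer.readInput x c.inHead)).2.2 } :=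
  .done hs (by simp [step, act, HeadMove.apply])

theorem exec_ret (e : E) (hs : c.head < s) (hc : c.inHead ≤ x.length + 1) :
    (ret e).Exec x s c e c :=
  .done hs (by simp [step, act, ret, HeadMove.apply, hc])

/-- A work tape with end marker in cell `0` and `L` digits. -/
def digitTape (L : ℕ) (d : ℕ → R → Bool) : ℕ → TapeSym R
  | 0 => .wall
  | j + 1 => if j < L then .digit (d j) else .blank

theorem exec_putWall (h : ℕ) (hh : h ≤ x.length + 1) (hs : 0 < s) (d : ℕ → R → Bool)
    (out : List Bool) :
    putWall.Exec x s ⟨h, fun _ => .blank, 0, out⟩ () ⟨h, digitTape 0 d, 0, out⟩ := by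
  refine .done hs ?_
  simp only [step, putWall, HeadMove.apply, Prod.mk.injEq, Conf.mk.injEq, true_and,
    List.append_nil, and_true]
  refine ⟨by simpa using hh, ?_⟩
  funext j
  cases j <;> simp [digitTape]

/-! ### Correctness of a pass over the digits. -/

section Sweep

variable {S : Type} [Finite S] {s₀ : S} {δ : S → (R → Bool) → S × (R → Bool)}
  {fin : S → Option (R → Bool)}

theorem sweep_run_left (h : ℕ) (hh : h ≤ x.length + 1) (q : S) (L : ℕ) (d : ℕ → R → Bool)
    (out : List Bool) (j : ℕ) (hj : j < s) :
    (sweep s₀ δ fin).Run x s (some (.inr q)) ⟨h, digitTape L d, j, out⟩ q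
      ⟨h, digitTape L d, 0, out⟩ := by
  induction j with
  | zero =>
    refine .done hj ?_
    simp [step, sweep, digitTape, HeadMove.apply, hh]
  | succ j ih =>
    refine .next hj ?_ (ih (by omega))
    by_cases hjL : j < L <;>
      simp [step, sweep, digitTape, HeadMove.apply, hh, hjL]

/-- Digit `j` lies in cell `j + 1`, since the end marker occupies cell `0`. The digits to the left
of the head are already rewritten. The blank that ends the pass is in cell `L + 1`, whence the space
`L + 2`. -/
theorem sweep_run_right (h : ℕ) (hh : h ≤ x.length + 1) (L : ℕ) (d d' : ℕ → R → Bool) (st : ℕ → S)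
    (hδ : ∀ j < L, δ (st j) (d j) = (st (j + 1), d' j)) (out : List Bool) (hs : L + 2 ≤ s)
    (L' : ℕ) (hfin : (match fin (st L) with | none => L' = L | some e => L' = L + 1 ∧ d' L = e))
    (m j : ℕ) (hj : j + m = L) :
    (sweep s₀ δ fin).Run x s (some (.inl (st j)))
      ⟨h, digitTape L (fun i => if i < j then d' i else d i), j + 1, out⟩ (st L)
      ⟨h, digitTape L' d', 0, out⟩ := by
  induction m generalizing j with
  | zero =>
    obtain rfl : j = L := hj
    refine .next (by simp; omega) ?_
      (sweep_run_left h hh (st j) L' d' out j (by omega))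
    simp only [step, sweep, digitTape, lt_irrefl, if_false, HeadMove.apply, hh, inf_of_le_left,
      List.append_nil, Prod.mk.injEq, Conf.mk.injEq, true_and, Nat.add_sub_cancel, and_true]
    funext i
    rcases hf : fin (st j) with _ | e
    · simp only [hf] at hfin
      subst hfin
      cases i with
      | zero => simp [digitTape]
      | succ i =>
        rcases lt_trichotomy i L' with hi | rfl | hi
        · simp [digitTape, hi, hi.ne]
        · simp [digitTape]
        · simp [digitTape, hi.ne', hi.not_gt]
    · simp only [hf] at hfin
      obtain ⟨rfl, rfl⟩ := hfin
      cases i with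
      | zero => simp [digitTape]
      | succ i =>
        rcases lt_trichotomy i j with hi | rfl | hi
        · simp [digitTape, hi, hi.ne, hi.trans]
        · simp [digitTape]
        · simp [digitTape, hi.ne', hi.not_gt, show ¬ i < j + 1 by omega]
  | succ m ih =>
    have hjL : j < L := by omega
    refine .next (by simp; omega) ?_ (ih (j + 1) (by omega))
    simp only [step, sweep, digitTape, hjL, if_true, lt_irrefl, if_false, HeadMove.apply, hh,
      inf_of_le_left, List.append_nil, Prod.mk.injEq, Conf.mk.injEq, true_and, and_true, hδ j hjL]
    funext i
    cases i with
    | zero => simp [digitTape]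
    | succ i =>
      rcases lt_trichotomy i j with hi | rfl | hi
      · simp [digitTape, hi, hi.ne, show i < j + 1 by omega]
      · simp [digitTape, hjL]
      · simp [digitTape, hi.ne', hi.not_gt, show ¬ i < j + 1 by omega]

/-- The trajectory `st` of the automaton is supplied from outside, so that callers can describe its
states by a closed formula instead of iterating `δ`. -/
theorem exec_sweep {h : ℕ} (hh : h ≤ x.length + 1) {L L' : ℕ} {d d' : ℕ → R → Bool} (st : ℕ → S)
    (h₀ : st 0 = s₀) (hδ : ∀ j < L, δ (st j) (d j) = (st (j + 1), d' j)) (out : List Bool)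
    (hs : L + 2 ≤ s)
    (hfin : (match fin (st L) with | none => L' = L | some e => L' = L + 1 ∧ d' L = e)) :
    (sweep s₀ δ fin).Exec x s ⟨h, digitTape L d, 0, out⟩ (st L) ⟨h, digitTape L' d', 0, out⟩ := by
  refine .next (by simp; omega) ?_
    (sweep_run_right h hh L d d' st hδ out hs L' hfin L 0 (by omega))
  simp only [step, sweep, digitTape, HeadMove.apply, hh, inf_of_le_left, List.append_nil,
    Prod.mk.injEq, Conf.mk.injEq, true_and, and_true, h₀, Nat.not_lt_zero, if_false]
  funext i
  cases i <;> simp [digitTape]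

end Sweep

/-! ### From fragments to transducers -/

/-- The machine that runs a fragment on a single work tape. -/
def toTransducer [Finite R] (F : Frag R E) [Finite E] : Transducer where
  State := F.State ⊕ E
  WorkSym := TapeSym R
  WorkTape := Unit
  finite_state := have := F.finite_state; inferInstance
  finite_workSym := inferInstance
  finite_workTape := inferInstance
  start := .inl F.entry
  blank := .blank
  trans
    | .inl q, a, t =>
      let r := F.trans q a (t ())
      some (r.1, r.2.1, fun _ => (r.2.2.1, r.2.2.2.1), r.2.2.2.2)
    | .inr _, _, _ => none

/-- The configuration of the machine that corresponds to one of the fragment. -/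
def config [Finite R] (F : Frag R E) [Finite E] (q : F.State ⊕ E) (c : Conf R) :
    F.toTransducer.Config where
  state := q
  inHead := c.inHead
  work _ := c.tape
  head _ := c.head
  out := c.out

theorem step_config [Finite R] [Finite E] (F : Frag R E) (q : F.State) (c : Conf R) :
    F.toTransducer.step x (F.config (.inl q) c) =
      some (F.config (F.step x q c).1 (F.step x q c).2) := by
  simp only [Transducer.step, toTransducer, config, step, Option.map_some]
  congr 2
  funext _ j
  by_cases hj : j = c.head <;> simp [hj]

/-- The machine is deterministic, so every reachable configuration lies on the given run and
inherits its space bound. `Run` checks the head only before each step; `hc'` covers the halting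
configuration. -/
theorem reachable_of_run [Finite R] [Finite E] {F : Frag R E} {q : F.State} {e : E}
    (h : F.Run x s q c e c') (hc' : c'.head < s) :
    Relation.ReflTransGen (fun c₁ c₂ => F.toTransducer.step x c₁ = some c₂)
      (F.config (.inl q) c) (F.config (.inr e) c') ∧
    ∀ d, Relation.ReflTransGen (fun c₁ c₂ => F.toTransducer.step x c₁ = some c₂)
      (F.config (.inl q) c) d → d.head () < s := by
  induction h with
  | @done q c _ _ hs h =>
    have h₁ := F.step_config (x := x) q c
    rw [h] at h₁
    refine ⟨.single h₁, fun d hd => ?_⟩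
    rcases hd.cases_head with rfl | ⟨d₁, hd₁, hd⟩
    · exact hs
    · obtain rfl := Option.some.inj (h₁.symm.trans hd₁)
      rcases hd.cases_head with rfl | ⟨d₂, hd₂, -⟩
      · exact hc'
      · simp [Transducer.step, toTransducer, config] at hd₂
  | @next q c _ _ _ _ hs h _ ih =>
    have h₁ := F.step_config (x := x) q c
    rw [h] at h₁
    refine ⟨.head h₁ (ih hc').1, fun d hd => ?_⟩
    rcases hd.cases_head with rfl | ⟨d₁, hd₁, hd⟩
    · exact hs
    · obtain rfl := Option.some.inj (h₁.symm.trans hd₁)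
      exact (ih hc').2 d hd

theorem toTransducer_outputs [Finite R] [Finite E] {F : Frag R E} {e : E}
    (h : F.Exec x s ⟨0, fun _ => .blank, 0, []⟩ e c') (hc' : c'.head < s) :
    F.toTransducer.Outputs x c'.out ∧ F.toTransducer.RunsInSpace x s :=
  ⟨⟨F.config (.inr e) c', (reachable_of_run h hc').1, rfl, rfl⟩,
    fun d hd _ => (reachable_of_run h hc').2 d hd⟩

end Frag

/-! ### Binary registers -/

/-- When `1` is added to `m`, a carry enters position `j` exactly if all lower bits are `1`, that
is, if `2 ^ j ∣ m + 1`. Halving reduces an odd `m` to `m / 2`; for even `m` there is no carry beyond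
position `0`. -/
theorem Nat.testBit_add_one_eq_xor (m j : ℕ) :
    (m + 1).testBit j = ((decide (2 ^ j ∣ m + 1)) ^^ (m.testBit j)) := by
  induction j generalizing m with
  | zero =>
    rcases Nat.mod_two_eq_zero_or_one m with h | h <;>
      simp [Nat.add_mod, h]
  | succ j ih =>
    rw [Nat.testBit_succ, Nat.testBit_succ]
    rcases Nat.mod_two_eq_zero_or_one m with h | h
    · have h₁ : (m + 1) / 2 = m / 2 := by omega
      have h₂ : ¬ 2 ^ (j + 1) ∣ m + 1 := fun h' => by
        have := (Dvd.intro_left _ (pow_succ 2 j).symm).trans h'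
        omega
      simp [h₁, h₂]
    · have h₁ : (m + 1) / 2 = m / 2 + 1 := by omega
      have h₂ : m + 1 = (m / 2 + 1) * 2 := by omega
      rw [h₁, ih, h₂, pow_succ]
      simp [Nat.mul_dvd_mul_iff_right]

theorem Nat.two_pow_succ_dvd_add_one_iff (m j : ℕ) :
    2 ^ (j + 1) ∣ m + 1 ↔ 2 ^ j ∣ m + 1 ∧ m.testBit j = true := by
  induction j generalizing m with
  | zero => simp; omega
  | succ j ih =>
    rw [Nat.testBit_succ]
    rcases Nat.mod_two_eq_zero_or_one m with h | h
    · have h₂ : ∀ i, ¬ 2 ^ (i + 1) ∣ m + 1 := fun i h' => by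
        have := (Dvd.intro_left _ (pow_succ 2 i).symm).trans h'
        omega
      simp [h₂]
    · have h₂ : m + 1 = (m / 2 + 1) * 2 := by omega
      rw [h₂, pow_succ, Nat.mul_dvd_mul_iff_right two_pos, ih, pow_succ 2 j,
        Nat.mul_dvd_mul_iff_right two_pos]

namespace Frag

variable {R : Type} {x : List Bool} {s : ℕ}

/-- The work tape on which the registers `ρ` are stored with `L` binary digits. -/
def regTape (L : ℕ) (ρ : R → ℕ) : ℕ → TapeSym R :=
  digitTape L fun j r => (ρ r).testBit j

/-- A configuration between two operations on registers. -/
def conf (L : ℕ) (ρ : R → ℕ) (h : ℕ) (out : List Bool) : Conf R :=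
  ⟨h, regTape L ρ, 0, out⟩

/-- Compare two registers. -/
def regEq (r r' : R) : Frag R Bool :=
  sweep true (fun c d => (c && d r == d r', d)) (fun _ => none)

theorem exec_regEq {L : ℕ} {ρ : R → ℕ} (r r' : R) {h : ℕ} (hh : h ≤ x.length + 1)
    (out : List Bool) (hs : L + 2 ≤ s) (hρ : ∀ r, ρ r < 2 ^ L) :
    (regEq r r').Exec x s (conf L ρ h out) (decide (ρ r = ρ r')) (conf L ρ h out) := by
  -- Both numbers are below `2 ^ L`, so their bits from position `L` on vanish.
  have key : decide (ρ r = ρ r') = decide (∀ i < L, (ρ r).testBit i = (ρ r').testBit i) := by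
    refine decide_eq_decide.2 ⟨fun h i _ => h ▸ rfl, fun h => Nat.eq_of_testBit_eq fun i => ?_⟩
    by_cases hi : i < L
    · exact h i hi
    · have : 2 ^ L ≤ 2 ^ i := Nat.pow_le_pow_right two_pos (not_lt.1 hi)
      rw [Nat.testBit_lt_two_pow ((hρ r).trans_le this),
        Nat.testBit_lt_two_pow ((hρ r').trans_le this)]
  rw [key]
  refine exec_sweep hh
    (fun j => decide (∀ i < j, (ρ r).testBit i = (ρ r').testBit i)) (by simp) ?_ out hs (by simp)
  intro j _
  simp only [Prod.mk.injEq, and_true, Nat.forall_lt_succ_right, Bool.decide_and]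
  rw [Bool.beq_eq_decide_eq]

section Registers

variable [DecidableEq R]

/-- Increment a register. -/
def inc (r : R) : Frag R Unit :=
  (sweep true (fun c d => (c && d r, Function.update d r (c ^^ d r)))
    (fun c => if c then some (Function.update (fun _ => false) r true) else none)).bind
  fun _ => ret ()

/-- Set a register to zero. -/
def reset (r : R) : Frag R Unit :=
  sweep () (fun _ d => ((), Function.update d r false)) (fun _ => none)

/-- The state before digit `j` is the carry `2 ^ j ∣ ρ r + 1`. A carry left over after `L` digits
means `ρ r + 1 = 2 ^ L`; only then is a digit appended, `1` for `r` and `0` for the other registers.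
-/
theorem exec_inc {L L' : ℕ} {ρ : R → ℕ} (r : R) {h : ℕ} (hh : h ≤ x.length + 1) (out : List Bool)
    (hs : L + 2 ≤ s) (hρ : ∀ r, ρ r < 2 ^ L)
    (hL : L' = if ρ r + 1 = 2 ^ L then L + 1 else L) :
    (inc r).Exec x s (conf L ρ h out) () (conf L' (Function.update ρ r (ρ r + 1)) h out) := by
  refine exec_bind (exec_sweep hh (fun j => decide (2 ^ j ∣ ρ r + 1)) (by simp) ?_ out hs ?_)
    (exec_ret () (by simp; omega) hh)
  · intro j _
    simp only [Nat.two_pow_succ_dvd_add_one_iff, Prod.mk.injEq]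
    refine ⟨by simp, ?_⟩
    funext r'
    by_cases hr : r' = r
    · subst hr
      simp [Nat.testBit_add_one_eq_xor]
    · simp [hr]
  · have hd : 2 ^ L ∣ ρ r + 1 ↔ ρ r + 1 = 2 ^ L :=
      ⟨fun h' => le_antisymm (hρ r) (Nat.le_of_dvd (Nat.succ_pos _) h'), fun h' => h' ▸ dvd_rfl⟩
    by_cases he : ρ r + 1 = 2 ^ L
    · simp only [he, dvd_refl, decide_true, if_true] at hL ⊢
      refine ⟨hL, ?_⟩
      funext r'
      by_cases hr : r' = r
      · subst hr
        simp
      · simp [hr, Nat.testBit_lt_two_pow (hρ r')]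
    · simp [hd, he, hL]

theorem exec_inc_of_lt {L : ℕ} {ρ : R → ℕ} (r : R) {h : ℕ} (hh : h ≤ x.length + 1)
    (out : List Bool) (hs : L + 2 ≤ s) (hρ : ∀ r, ρ r < 2 ^ L) (hr : ρ r + 1 < 2 ^ L) :
    (inc r).Exec x s (conf L ρ h out) () (conf L (Function.update ρ r (ρ r + 1)) h out) :=
  exec_inc r hh out hs hρ (by simp [hr.ne])

theorem exec_reset {L : ℕ} {ρ : R → ℕ} (r : R) {h : ℕ} (hh : h ≤ x.length + 1)
    (out : List Bool) (hs : L + 2 ≤ s) :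
    (reset r).Exec x s (conf L ρ h out) () (conf L (Function.update ρ r 0) h out) := by
  refine exec_sweep hh (fun _ => ()) rfl ?_ out hs (by simp)
  intro j _
  simp only [Prod.mk.injEq, true_and]
  funext r'
  by_cases hr : r' = r
  · subst hr
    simp
  · simp [hr]

/-! ### Loops over a register -/

/-- Run the body for the values `0, 1, …` of the counter `c` below the value of `b`, until it
returns `true`; return whether it did. -/
def anyFor (c b : R) (body : Frag R Bool) : Frag R Bool :=
  (loop ((regEq c b).bind fun e => if e then ret (some false) else
    body.bind fun r => if r then ret (some true) else (inc c).bind fun _ => ret none)).bind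
  fun r => (reset c).bind fun _ => ret r

/-- Here `m` is the number of passes that return `false`: either the counter then reaches the bound,
or the next pass returns `true`. The functions `hd` and `outs` record head position and output
between passes. The final reset restores `ρ`, which makes loops nestable. -/
theorem exec_anyFor {L : ℕ} {ρ : R → ℕ} {c b : R} (hcb : c ≠ b) {body : Frag R Bool}
    (hs : L + 2 ≤ s) (hρ : ∀ r, ρ r < 2 ^ L) (hc : ρ c = 0) (hd : ℕ → ℕ) (outs : ℕ → List Bool)
    (m : ℕ) (hm : m ≤ ρ b) (hhd : ∀ i ≤ m, hd i ≤ x.length + 1)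
    (hbody : ∀ i < m, body.Exec x s (conf L (Function.update ρ c i) (hd i) (outs i)) false
      (conf L (Function.update ρ c i) (hd (i + 1)) (outs (i + 1))))
    {e : Bool} {hd' : ℕ} {out' : List Bool} (hhd' : hd' ≤ x.length + 1)
    (hend : if m = ρ b then e = false ∧ hd' = hd m ∧ out' = outs m else
      e = true ∧ body.Exec x s (conf L (Function.update ρ c m) (hd m) (outs m)) true
        (conf L (Function.update ρ c m) hd' out')) :
    (anyFor c b body).Exec x s (conf L ρ (hd 0) (outs 0)) e (conf L ρ hd' out') := by
  have hlt : ∀ i ≤ m, ∀ r, Function.update ρ c i r < 2 ^ L := by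
    intro i hi r
    by_cases hr : r = c
    · subst hr
      simpa using (hi.trans hm).trans_lt (hρ b)
    · simpa [hr] using hρ r
  have hs0 : 0 < s := by omega
  suffices H : ∀ j i, i + j = m →
      (loop ((regEq c b).bind fun e => if e then ret (some false) else
        body.bind fun r => if r then ret (some true) else
          (inc c).bind fun _ => ret none)).Exec x s
        (conf L (Function.update ρ c i) (hd i) (outs i)) e
        (conf L (Function.update ρ c m) hd' out') by
    have h₀ := H m 0 (by omega)
    rw [show Function.update ρ c 0 = ρ by rw [← hc, Function.update_eq_self]] at h₀
    have h₁ := exec_reset (ρ := Function.update ρ c m) c hhd' out' hs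
    rw [Function.update_idem, ← hc, Function.update_eq_self] at h₁
    exact exec_bind h₀ (exec_bind h₁ (exec_ret e hs0 hhd'))
  intro j
  induction j with
  | zero =>
    intro i hi
    obtain rfl : i = m := hi
    refine exec_loop_some (exec_bind (exec_regEq c b (hhd i le_rfl) _ hs (hlt i le_rfl)) ?_)
    simp only [Function.update_self, Function.update_of_ne hcb.symm]
    by_cases hi : i = ρ b
    · simp only [hi, if_true] at hend
      obtain ⟨rfl, rfl, rfl⟩ := hend
      simp only [hi, decide_true, if_true]
      exact exec_ret _ hs0 hhd'
    · simp only [hi, if_false] at hend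
      obtain ⟨rfl, hend⟩ := hend
      simp only [hi, decide_false, Bool.false_eq_true, if_false]
      exact exec_bind hend (exec_ret _ hs0 hhd')
  | succ j ih =>
    intro i hi
    refine exec_loop_none
      (exec_bind (exec_regEq c b (hhd i (by omega)) _ hs (hlt i (by omega))) ?_)
      (ih (i + 1) (by omega))
    simp only [Function.update_self, Function.update_of_ne hcb.symm,
      show i ≠ ρ b by omega, decide_false, Bool.false_eq_true, if_false]
    refine exec_bind (hbody i (by omega)) ?_
    simp only [Bool.false_eq_true, if_false]
    -- The counter stays at most `ρ b < 2 ^ L`, so loops never lengthen the tape.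
    have h₁ := exec_inc_of_lt (ρ := Function.update ρ c i) c (hhd (i + 1) (by omega))
      (outs (i + 1)) hs (hlt i (by omega)) (by have := hρ b; simp; omega)
    simp only [Function.update_self, Function.update_idem] at h₁
    exact exec_bind h₁ (exec_ret _ hs0 (hhd (i + 1) (by omega)))

/-! ### Specifications of fragments that preserve the registers. -/

/-- The fragment moves the input head `d` cells to the right, or to the right end. -/
def Moves (F : Frag R Bool) (x : List Bool) (s L : ℕ) (ρ : R → ℕ) (d : ℕ) : Prop :=
  ∀ h ≤ x.length + 1, ∀ out,
    F.Exec x s (conf L ρ h out) false (conf L ρ (min (h + d) (x.length + 1)) out)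

/-- The fragment moves the input head to cell `p`, or to the right end. -/
def Seeks (F : Frag R Bool) (x : List Bool) (s L : ℕ) (ρ : R → ℕ) (p : ℕ) : Prop :=
  ∀ h ≤ x.length + 1, ∀ out,
    F.Exec x s (conf L ρ h out) false (conf L ρ (min p (x.length + 1)) out)

/-- The fragment returns `b` and appends `w` to the output. -/
def Yields (F : Frag R Bool) (x : List Bool) (s L : ℕ) (ρ : R → ℕ) (b : Bool) (w : List Bool) :
    Prop :=
  ∀ h ≤ x.length + 1, ∃ h' ≤ x.length + 1, ∀ out,
    F.Exec x s (conf L ρ h out) b (conf L ρ h' (out ++ w))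

/-- Truncating at the right end after every pass has the same effect as truncating once at the end,
so distances add up, and nested loops walk over products. -/
theorem Moves.anyFor {L : ℕ} {ρ : R → ℕ} {c b : R} (hcb : c ≠ b) {body : Frag R Bool}
    (hs : L + 2 ≤ s) (hρ : ∀ r, ρ r < 2 ^ L) (hc : ρ c = 0) {d : ℕ}
    (hbody : ∀ i < ρ b, Moves body x s L (Function.update ρ c i) d) :
    Moves (anyFor c b body) x s L ρ (ρ b * d) := by
  intro h hh out
  have := exec_anyFor (x := x) (body := body) hcb hs hρ hc (fun i => min (h + i * d) (x.length + 1)) (fun _ => out)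
    (ρ b) le_rfl (fun _ _ => min_le_right _ _)
    (fun i hi => ?_) (e := false) (min_le_right (h + ρ b * d) _) (out' := out) (by simp)
  · simpa [hh] using this
  · have := hbody i hi (min (h + i * d) (x.length + 1)) (min_le_right _ _) out
    convert this using 2
    rw [Nat.succ_mul]
    omega

theorem Yields.anyFor_of_le {L : ℕ} {ρ : R → ℕ} {c b : R} (hcb : c ≠ b) {body : Frag R Bool}
    (hs : L + 2 ≤ s) (hρ : ∀ r, ρ r < 2 ^ L) (hc : ρ c = 0) {w : ℕ → List Bool}
    {m : ℕ} (hm : m ≤ ρ b)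
    (hbody : ∀ i < m, Yields body x s L (Function.update ρ c i) false (w i)) {e : Bool}
    (hend : if m = ρ b then e = false else
      e = true ∧ Yields body x s L (Function.update ρ c m) true []) :
    Yields (anyFor c b body) x s L ρ e ((List.range m).flatMap w) := by
  intro h hh
  -- The head position after a pass depends on the one before it but not on the output, so the
  -- positions between passes arise by iterating the chosen functions `g i`.
  choose! g hg hg' using hbody
  let hd : ℕ → ℕ := fun i => Nat.rec h g i
  have hhd : ∀ i ≤ m, hd i ≤ x.length + 1 := by
    intro i
    induction i with
    | zero => exact fun _ => hh
    | succ i ih => exact fun hi => hg i hi _ (ih (by omega))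
  have hstep : ∀ out, ∀ i < m, body.Exec x s
      (conf L (Function.update ρ c i) (hd i) (out ++ (List.range i).flatMap w)) false
      (conf L (Function.update ρ c i) (hd (i + 1)) (out ++ (List.range (i + 1)).flatMap w)) := by
    intro out i hi
    have := hg' i hi (hd i) (hhd i hi.le) (out ++ (List.range i).flatMap w)
    simpa [List.range_succ] using this
  by_cases hmb : m = ρ b
  · rw [if_pos hmb] at hend
    subst hend
    refine ⟨hd m, hhd m le_rfl, fun out => ?_⟩
    have := exec_anyFor (x := x) (body := body) hcb hs hρ hc hd
      (fun i => out ++ (List.range i).flatMap w) m hm hhd (hstep out) (hhd m le_rfl)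
      (e := false) (out' := out ++ (List.range m).flatMap w) (by simp [hmb])
    simpa [hd] using this
  · rw [if_neg hmb] at hend
    obtain ⟨rfl, hend⟩ := hend
    obtain ⟨h', hh', hx⟩ := hend (hd m) (hhd m le_rfl)
    refine ⟨h', hh', fun out => ?_⟩
    have := exec_anyFor (x := x) (body := body) hcb hs hρ hc hd
      (fun i => out ++ (List.range i).flatMap w) m hm hhd (hstep out) hh'
      (e := true) (out' := out ++ (List.range m).flatMap w)
      (by simpa [hmb] using hx (out ++ (List.range m).flatMap w))
    simpa [hd] using this

theorem Yields.forEach {L : ℕ} {ρ : R → ℕ} {c b : R} (hcb : c ≠ b) {body : Frag R Bool}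
    (hs : L + 2 ≤ s) (hρ : ∀ r, ρ r < 2 ^ L) (hc : ρ c = 0) {w : ℕ → List Bool}
    (hbody : ∀ i < ρ b, Yields body x s L (Function.update ρ c i) false (w i)) :
    Yields (anyFor c b body) x s L ρ false ((List.range (ρ b)).flatMap w) :=
  Yields.anyFor_of_le hcb hs hρ hc le_rfl hbody (by simp)

theorem Yields.exists {L : ℕ} {ρ : R → ℕ} {c b : R} (hcb : c ≠ b) {body : Frag R Bool}
    (hs : L + 2 ≤ s) (hρ : ∀ r, ρ r < 2 ^ L) (hc : ρ c = 0) {f : ℕ → Bool}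
    (hbody : ∀ i < ρ b, Yields body x s L (Function.update ρ c i) (f i) []) :
    Yields (anyFor c b body) x s L ρ (decide (∃ i < ρ b, f i = true)) [] := by
  by_cases hf : ∃ i < ρ b, f i = true
  · classical
    -- The loop stops at the least index at which `f` is true.
    obtain ⟨hm, hm'⟩ := Nat.find_spec hf
    have := Yields.anyFor_of_le (w := fun _ => []) (e := true) hcb hs hρ hc hm.le (fun i hi => ?_)
      (by simpa [hm.ne, hm'] using hbody _ hm)
    · rwa [List.flatMap_eq_nil_iff.2 fun _ _ => rfl, ← decide_eq_true hf] at this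
    · have := Nat.find_min hf hi
      have hfi : f i = false := by simpa [hi.trans hm] using this
      simpa [hfi] using hbody i (hi.trans hm)
  · have := Yields.anyFor_of_le (x := x) (body := body) (w := fun _ => []) (e := false) hcb hs hρ
      hc le_rfl (fun i hi => ?_) (by simp)
    · rwa [List.flatMap_eq_nil_iff.2 fun _ _ => rfl, ← decide_eq_false hf] at this
    · have hfi : f i = false := by simpa using fun h => hf ⟨i, hi, h⟩
      simpa [hfi] using hbody i hi

end Registers

/-! ### Sequential composition and elementary steps -/

variable {L : ℕ} {ρ : R → ℕ}

/-- Move the input head to the left end. -/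
def rewind : Frag R Bool :=
  loop (act fun a => match a with
    | .leftEnd => (some false, .stay, [])
    | _ => (none, .left, []))

/-- Move the input head one cell to the right. -/
def right : Frag R Bool := act fun _ => (false, .right, [])

/-- Return the input bit below the head. -/
def readBit : Frag R Bool :=
  act fun a => match a with
    | .bit b => (b, .stay, [])
    | _ => (false, .stay, [])

/-- Append a bit to the output. -/
def emit (b : Bool) : Frag R Bool := act fun _ => (false, .stay, [b])

theorem seeks_rewind (hs : 0 < s) : Seeks (rewind : Frag R Bool) x s L ρ 0 := by
  intro h hh out
  rw [Nat.zero_min]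
  induction h with
  | zero =>
    refine exec_loop_some ?_
    simpa [conf, Transducer.readInput, HeadMove.apply] using
      exec_act (x := x) (s := s) (c := conf L ρ 0 out) (fun a => match a with
        | .leftEnd => (some false, .stay, [])
        | _ => (none, .left, [])) hs
  | succ h ih =>
    refine exec_loop_none ?_ (ih (by omega))
    have := exec_act (x := x) (s := s) (c := conf L ρ (h + 1) out) (fun a => match a with
        | .leftEnd => (some false, .stay, [])
        | _ => (none, .left, [])) hs
    rcases hb : x[h]? with _ | b <;>
      simpa [conf, Transducer.readInput, HeadMove.apply, hb, show h ≤ x.length + 1 by omega]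
        using this

theorem moves_right (hs : 0 < s) : Moves (right : Frag R Bool) x s L ρ 1 := by
  intro h hh out
  simpa [conf, HeadMove.apply, right] using
    exec_act (x := x) (s := s) (c := conf L ρ h out) (fun _ => (false, .right, [])) hs

theorem exec_right (hs : 0 < s) {h : ℕ} (hh : h ≤ x.length) (out : List Bool) :
    (right : Frag R Bool).Exec x s (conf L ρ h out) false (conf L ρ (h + 1) out) := by
  simpa [hh] using moves_right (x := x) (L := L) (ρ := ρ) hs h (by omega) out

theorem exec_readBit (hs : 0 < s) {i : ℕ} {b : Bool} (hi : x[i]? = some b) (out : List Bool) :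
    (readBit : Frag R Bool).Exec x s (conf L ρ (i + 1) out) b (conf L ρ (i + 1) out) := by
  have hil : i < x.length := (List.getElem?_eq_some_iff.1 hi).1
  have := exec_act (x := x) (s := s) (c := conf L ρ (i + 1) out) (fun a => match a with
    | .bit b => (b, .stay, [])
    | _ => (false, .stay, [])) hs
  simpa [conf, HeadMove.apply, Transducer.readInput, hi, readBit,
    show i ≤ x.length by omega] using this

theorem exec_emit (hs : 0 < s) (b : Bool) {h : ℕ} (hh : h ≤ x.length + 1) (out : List Bool) :
    (emit b : Frag R Bool).Exec x s (conf L ρ h out) false (conf L ρ h (out ++ [b])) := by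
  simpa [conf, HeadMove.apply, hh, emit] using
    exec_act (x := x) (s := s) (c := conf L ρ h out) (fun _ => (false, .stay, [b])) hs

theorem yields_emit (hs : 0 < s) (b : Bool) :
    Yields (emit b : Frag R Bool) x s L ρ false [b] :=
  fun h hh => ⟨h, hh, fun out => exec_emit hs b hh out⟩

theorem yields_ret (hs : 0 < s) (b : Bool) :
    Yields (ret b : Frag R Bool) x s L ρ b [] :=
  fun h hh => ⟨h, hh, fun out => by simpa using exec_ret b hs hh⟩

theorem Seeks.bind {F : Frag R Bool} {G : Bool → Frag R Bool} {p d : ℕ}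
    (hF : Seeks F x s L ρ p) (hG : Moves (G false) x s L ρ d) :
    Seeks (F.bind G) x s L ρ (p + d) := by
  intro h hh out
  have := hG (min p (x.length + 1)) (min_le_right _ _) out
  rw [show min (min p (x.length + 1) + d) (x.length + 1) = min (p + d) (x.length + 1) by omega]
    at this
  exact exec_bind (hF h hh out) this

theorem Seeks.yields {F : Frag R Bool} {i : ℕ} {b : Bool}
    (hF : Seeks F x s L ρ (i + 1)) (hs : 0 < s) (hi : x[i]? = some b) :
    Yields (F.bind fun _ => readBit) x s L ρ b [] := by
  have hil : i < x.length := (List.getElem?_eq_some_iff.1 hi).1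
  intro h hh
  refine ⟨i + 1, by omega, fun out => exec_bind (c₁ := conf L ρ (i + 1) out) (e := false) ?_ ?_⟩
  · simpa [show i ≤ x.length by omega] using hF h hh out
  · simpa using exec_readBit hs hi out

theorem Yields.bind {F : Frag R Bool} {G : Bool → Frag R Bool} {b b' : Bool} {w w' : List Bool}
    (hF : Yields F x s L ρ b w) (hG : Yields (G b) x s L ρ b' w') :
    Yields (F.bind G) x s L ρ b' (w ++ w') := by
  intro h hh
  obtain ⟨h₁, hh₁, hF⟩ := hF h hh
  obtain ⟨h₂, hh₂, hG⟩ := hG h₁ hh₁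
  refine ⟨h₂, hh₂, fun out => exec_bind (hF out) ?_⟩
  simpa using hG (out ++ w)

end Frag

/-! ### Three copies of a partitioned instance -/

/-- There is a chain `a = a₀, a₁, …, a_ℓ = b` of `ℓ` steps. -/
inductive Steps {α : Type} (r : α → α → Prop) (a : α) : ℕ → α → Prop
  | refl : Steps r a 0 a
  | tail {ℓ b c} : Steps r a ℓ b → r b c → Steps r a (ℓ + 1) c

namespace Steps

variable {α : Type} {r : α → α → Prop} {a b c : α} {ℓ m : ℕ}

theorem trans (h : Steps r a ℓ b) (h' : Steps r b m c) : Steps r a (ℓ + m) c := by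
  induction h' with
  | refl => exact h
  | tail _ hr ih => exact ih.tail hr

theorem iff_exists_seq :
    Steps r a ℓ b ↔ ∃ S : ℕ → α, S 0 = a ∧ S ℓ = b ∧ ∀ i < ℓ, r (S i) (S (i + 1)) := by
  constructor
  · intro h
    induction h with
    | refl => exact ⟨fun _ => a, rfl, rfl, by simp⟩
    | @tail ℓ b c _ hr ih =>
      obtain ⟨S, h₀, h₁, hS⟩ := ih
      refine ⟨fun i => if i ≤ ℓ then S i else c, by simp [h₀], by simp, fun i hi => ?_⟩
      rcases Nat.lt_succ_iff_lt_or_eq.1 hi with hi | rfl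
      · simpa [hi.le, Nat.succ_le_iff.2 hi] using hS i hi
      · simpa [h₁] using hr
  · rintro ⟨S, rfl, rfl, hS⟩
    suffices ∀ i ≤ ℓ, Steps r (S 0) i (S i) from this ℓ le_rfl
    intro i
    induction i with
    | zero => exact fun _ => .refl
    | succ i ih => exact fun hi => (ih (by omega)).tail (hS i hi)

end Steps

theorem IsJump.card_eq {V : Type} [DecidableEq V] {I J : Finset V} {u v : V}
    (h : IsJump I J u v) : J.card = I.card := by
  obtain ⟨hu, hv, rfl⟩ := h
  rw [Finset.card_insert_of_notMem (fun h => hv (Finset.mem_of_mem_erase h)),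
    Finset.card_erase_add_one hu]

/-- A jump to an independent set. -/
def ISRInstance.Move (A : ISRInstance) (I J : Finset (Fin A.n)) : Prop :=
  A.G.IsIndepSet (J : Set (Fin A.n)) ∧ ∃ u v, IsJump I J u v

/-- `Move` requires independence only of the set arrived at; `S 0` is independent because the
instance says so of `A.init`. -/
theorem ISRInstance.hasSequence_iff (A : ISRInstance) (ℓ : ℕ) :
    A.HasSequence ℓ ↔ Steps A.Move A.init ℓ A.target := by
  rw [Steps.iff_exists_seq]
  refine exists_congr fun S => and_congr_right fun h₀ => and_congr_right fun _ =>
    ⟨fun h i hi => ⟨h.1 _ hi, h.2 i hi⟩, fun h => ⟨fun i hi => ?_, fun i hi => (h i hi).2⟩⟩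
  cases i with
  | zero => exact h₀ ▸ A.init_indep
  | succ i => exact (h i hi).1

namespace PartitionedISRInstance

variable (A : PartitionedISRInstance)

/-- A jump within a token set to an independent set. -/
def Move (I J : Finset (Fin A.n)) : Prop :=
  A.G.IsIndepSet (J : Set (Fin A.n)) ∧ ∃ u v, IsJump I J u v ∧ A.part u = A.part v

theorem hasSequence_iff (ℓ : ℕ) : A.HasSequence ℓ ↔ Steps A.Move A.init ℓ A.target := by
  rw [Steps.iff_exists_seq]
  refine exists_congr fun S => and_congr_right fun h₀ => and_congr_right fun _ =>
    ⟨fun h i hi => ⟨h.1 _ hi, h.2 i hi⟩, fun h => ⟨fun i hi => ?_, fun i hi => (h i hi).2⟩⟩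
  cases i with
  | zero => exact h₀ ▸ A.init_indep
  | succ i => exact (h i hi).1

/-- An independent set with exactly one vertex in each token set. -/
def IsTransversal (I : Finset (Fin A.n)) : Prop :=
  A.G.IsIndepSet (I : Set (Fin A.n)) ∧ ∀ i, ∃! v, v ∈ I ∧ A.part v = i

variable {A}

theorem IsTransversal.inj {I : Finset (Fin A.n)} (h : A.IsTransversal I) {u v : Fin A.n}
    (hu : u ∈ I) (hv : v ∈ I) (huv : A.part u = A.part v) : u = v :=
  (h.2 _).unique ⟨hu, huv⟩ ⟨hv, rfl⟩

theorem IsTransversal.card {I : Finset (Fin A.n)} (h : A.IsTransversal I) : I.card = A.k := by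
  rw [← Fintype.card_fin A.k, ← Finset.card_univ]
  refine Finset.card_bij (fun v _ => A.part v) (by simp) (fun u hu v hv => h.inj hu hv) ?_
  intro i _
  obtain ⟨v, ⟨hv, hi⟩, -⟩ := h.2 i
  exact ⟨v, hv, hi⟩

theorem IsTransversal.move {I J : Finset (Fin A.n)} (h : A.IsTransversal I) (hm : A.Move I J) :
    A.IsTransversal J := by
  obtain ⟨hJ, u, v, ⟨hu, hv, rfl⟩, huv⟩ := hm
  refine ⟨hJ, fun i => ?_⟩
  obtain ⟨w, ⟨hw, rfl⟩, -⟩ := h.2 i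
  by_cases hwu : w = u
  · subst hwu
    refine ⟨v, ⟨by simp, huv.symm⟩, ?_⟩
    rintro z ⟨hz, hzw⟩
    rw [Finset.mem_insert, Finset.mem_erase] at hz
    exact hz.elim id fun hz => (hz.1 (h.inj hz.2 hu hzw)).elim
  · refine ⟨w, ⟨by simp [hwu, hw], rfl⟩, ?_⟩
    rintro z ⟨hz, hzw⟩
    rw [Finset.mem_insert, Finset.mem_erase] at hz
    rcases hz with rfl | hz
    · exact (hwu (h.inj hw hu (hzw.symm.trans huv.symm))).elim
    · exact h.inj hz.2 hw hzw

variable (A)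

/-- Two vertices are adjacent, or they are different and belong to the same token set. -/
def cliqueGraph : SimpleGraph (Fin A.n) where
  Adj u v := A.G.Adj u v ∨ u ≠ v ∧ A.part u = A.part v
  symm := ⟨fun _ _ h => h.imp (fun h => h.symm) fun h => ⟨h.1.symm, h.2.symm⟩⟩
  loopless := ⟨fun u h => h.elim (fun h => A.G.loopless.irrefl u h) fun h => h.1 rfl⟩

/-- Three disjoint copies of the graph `cliqueGraph`. -/
def tripleGraph : SimpleGraph (Fin (3 * A.n)) where
  Adj p q := (finProdFinEquiv.symm p).1 = (finProdFinEquiv.symm q).1 ∧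
    A.cliqueGraph.Adj (finProdFinEquiv.symm p).2 (finProdFinEquiv.symm q).2
  symm := ⟨fun _ _ h => ⟨h.1.symm, h.2.symm⟩⟩
  loopless := ⟨fun _ h => A.cliqueGraph.loopless.irrefl _ h.2⟩

/-! ### Vertex sets of three copies as triples of vertex sets. -/

variable {A} {n : ℕ}

/-- The set that consists of `K c` in the copy with index `c`. -/
def stack (K : Fin 3 → Finset (Fin n)) : Finset (Fin (3 * n)) :=
  Finset.univ.filter fun p => (finProdFinEquiv.symm p).2 ∈ K (finProdFinEquiv.symm p).1

/-- The part of a set in the copy with index `c`. -/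
def slice (J : Finset (Fin (3 * n))) (c : Fin 3) : Finset (Fin n) :=
  Finset.univ.filter fun u => finProdFinEquiv (c, u) ∈ J

theorem mem_stack (K : Fin 3 → Finset (Fin n)) (c : Fin 3) (u : Fin n) :
    finProdFinEquiv (c, u) ∈ stack K ↔ u ∈ K c := by
  simp [stack, -finProdFinEquiv_apply_val, -finProdFinEquiv_symm_apply]

theorem mem_slice (J : Finset (Fin (3 * n))) (c : Fin 3) (u : Fin n) :
    u ∈ slice J c ↔ finProdFinEquiv (c, u) ∈ J := by
  simp [slice]

theorem slice_stack (K : Fin 3 → Finset (Fin n)) (c : Fin 3) : slice (stack K) c = K c := by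
  ext u
  rw [mem_slice, mem_stack]

theorem card_eq_sum_slice (J : Finset (Fin (3 * n))) : J.card = ∑ c, (slice J c).card := by
  rw [← Finset.card_sigma]
  refine Finset.card_bij' (fun p _ => ⟨(finProdFinEquiv.symm p).1, (finProdFinEquiv.symm p).2⟩)
    (fun q _ => finProdFinEquiv (q.1, q.2)) ?_ ?_ ?_ ?_
  · intro p hp
    rw [Finset.mem_sigma, mem_slice, Prod.mk.eta, Equiv.apply_symm_apply]
    exact ⟨Finset.mem_univ _, hp⟩
  · rintro ⟨c, u⟩ h
    rw [Finset.mem_sigma, mem_slice] at h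
    exact h.2
  · intro p _
    rw [Prod.mk.eta, Equiv.apply_symm_apply]
  · rintro ⟨c, u⟩ _
    rw [Equiv.symm_apply_apply]

theorem tripleGraph_adj (c c' : Fin 3) (u v : Fin A.n) :
    A.tripleGraph.Adj (finProdFinEquiv (c, u)) (finProdFinEquiv (c', v)) ↔
      c = c' ∧ A.cliqueGraph.Adj u v := by
  simp only [tripleGraph, Equiv.symm_apply_apply]

theorem isIndepSet_tripleGraph_iff (J : Finset (Fin (3 * A.n))) :
    A.tripleGraph.IsIndepSet (J : Set (Fin (3 * A.n))) ↔
      ∀ c, A.cliqueGraph.IsIndepSet (slice J c : Set (Fin A.n)) := by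
  constructor
  · intro h c u hu v hv huv hadj
    rw [Finset.mem_coe, mem_slice] at hu hv
    refine h hu hv (fun he => huv ?_) ((tripleGraph_adj c c u v).2 ⟨rfl, hadj⟩)
    simpa using finProdFinEquiv.injective he
  · intro h p hp q hq hpq
    obtain ⟨⟨c, u⟩, rfl⟩ := finProdFinEquiv.surjective p
    obtain ⟨⟨c', v⟩, rfl⟩ := finProdFinEquiv.surjective q
    rw [tripleGraph_adj]
    rintro ⟨rfl, hadj⟩
    exact h c ((mem_slice J c u).2 hp) ((mem_slice J c v).2 hq) (fun he => hpq (by rw [he])) hadj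

theorem IsTransversal.isIndepSet_cliqueGraph {I : Finset (Fin A.n)} (h : A.IsTransversal I) :
    A.cliqueGraph.IsIndepSet (I : Set (Fin A.n)) := by
  rintro u hu v hv huv (hadj | ⟨-, hp⟩)
  exacts [h.1 hu hv huv hadj, huv (h.inj hu hv hp)]

theorem isIndepSet_stack {K : Fin 3 → Finset (Fin A.n)} (hK : ∀ c, A.IsTransversal (K c)) :
    A.tripleGraph.IsIndepSet (stack K : Set (Fin (3 * A.n))) := by
  rw [isIndepSet_tripleGraph_iff]
  intro c
  rw [slice_stack]
  exact (hK c).isIndepSet_cliqueGraph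

theorem card_stack {K : Fin 3 → Finset (Fin A.n)} (hK : ∀ c, A.IsTransversal (K c)) :
    (stack K).card = 3 * A.k := by
  simp [card_eq_sum_slice, slice_stack, (hK _).card]

/-- Token sets are cliques, so `part` is injective on each slice, which thus has at most `k`
elements. The three sizes sum to `3k`, so each equals `k`, and `part` is a bijection from each slice
to the indices. -/
theorem isTransversal_slice {J : Finset (Fin (3 * A.n))}
    (hJ : A.tripleGraph.IsIndepSet (J : Set (Fin (3 * A.n)))) (hcard : J.card = 3 * A.k)
    (c : Fin 3) : A.IsTransversal (slice J c) := by
  rw [isIndepSet_tripleGraph_iff] at hJ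
  have hinj : ∀ c, Set.InjOn A.part (slice J c : Set (Fin A.n)) := by
    intro c u hu v hv huv
    by_contra hne
    exact hJ c hu hv hne (.inr ⟨hne, huv⟩)
  have hle : ∀ c, (slice J c).card ≤ A.k := by
    intro c
    simpa using Finset.card_le_card_of_injOn (t := Finset.univ) A.part (by simp) (hinj c)
  have hk : A.k ≤ (slice J c).card := by
    rw [card_eq_sum_slice, Fin.sum_univ_three] at hcard
    have h₀ := hle 0
    have h₁ := hle 1
    have h₂ := hle 2
    fin_cases c <;> simp <;> omega
  refine ⟨fun u hu v hv huv hadj => hJ c hu hv huv (.inl hadj), fun i => ?_⟩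
  obtain ⟨v, hv, rfl⟩ := Finset.surjOn_of_injOn_of_card_le A.part (t := Finset.univ)
    (by intro; simp) (hinj c) (by simpa using hk) (Finset.mem_coe.2 (Finset.mem_univ i))
  exact ⟨v, ⟨hv, rfl⟩, fun z hz => hinj c hz.1 hv hz.2⟩

theorem isTransversal_init : A.IsTransversal A.init := ⟨A.init_indep, A.init_part⟩

theorem isTransversal_target : A.IsTransversal A.target := ⟨A.target_indep, A.target_part⟩

variable (A)

/-- Three disjoint copies of an instance, with the token sets turned into cliques. -/
def triple : ISRInstance where
  n := 3 * A.n
  G := A.tripleGraph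
  k := 3 * A.k
  init := stack fun _ => A.init
  target := stack fun _ => A.target
  init_indep := isIndepSet_stack fun _ => isTransversal_init
  target_indep := isIndepSet_stack fun _ => isTransversal_target
  init_card := card_stack fun _ => isTransversal_init
  target_card := card_stack fun _ => isTransversal_target

variable {A}

/-! ### Lifting sequences to the three copies. -/

theorem triple_move_stack {K : Fin 3 → Finset (Fin A.n)} (hK : ∀ c, A.IsTransversal (K c))
    {c : Fin 3} {J : Finset (Fin A.n)} (hJ : A.Move (K c) J) :
    A.triple.Move (stack K) (stack (Function.update K c J)) := by
  refine ⟨isIndepSet_stack fun c' => ?_, ?_⟩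
  · by_cases hc : c' = c
    · subst hc
      simpa using (hK c').move hJ
    · simpa [hc] using hK c'
  · obtain ⟨-, u, v, ⟨hu, hv, rfl⟩, -⟩ := hJ
    refine ⟨finProdFinEquiv (c, u), finProdFinEquiv (c, v), (mem_stack ..).2 hu,
      fun h => hv ((mem_stack ..).1 h), ?_⟩
    ext p
    obtain ⟨⟨c', w⟩, rfl⟩ := finProdFinEquiv.surjective p
    change _ ↔ finProdFinEquiv (c', w) ∈ insert (finProdFinEquiv (c, v))
      ((stack K).erase (finProdFinEquiv (c, u)))
    rw [Finset.mem_insert, Finset.mem_erase, mem_stack, mem_stack, EmbeddingLike.apply_eq_iff_eq,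
      Ne, EmbeddingLike.apply_eq_iff_eq, Prod.mk.injEq, Prod.mk.injEq]
    by_cases hc : c' = c
    · subst hc
      simp
    · simp [hc]

theorem steps_stack {K : Fin 3 → Finset (Fin A.n)} (hK : ∀ c, A.IsTransversal (K c))
    (c : Fin 3) {ℓ : ℕ} {J : Finset (Fin A.n)} (h : Steps A.Move (K c) ℓ J) :
    A.IsTransversal J ∧ Steps A.triple.Move (stack K) ℓ (stack (Function.update K c J)) := by
  induction h with
  | refl => exact ⟨hK c, by rw [Function.update_eq_self]; exact .refl⟩
  | @tail ℓ J J' _ hm ih =>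
    refine ⟨ih.1.move hm, ih.2.tail ?_⟩
    have := triple_move_stack (K := Function.update K c J) (c := c) (J := J') (fun c' => ?_)
      (by simpa using hm)
    · simpa using this
    · by_cases hc : c' = c
      · subst hc
        simpa using ih.1
      · simpa [hc] using hK c'

theorem HasSequence.triple {ℓ : ℕ} (h : A.HasSequence ℓ) : A.triple.HasSequence (3 * ℓ) := by
  rw [hasSequence_iff] at h
  rw [ISRInstance.hasSequence_iff]
  have h₀ := steps_stack (K := fun _ => A.init) (fun _ => isTransversal_init) 0 h
  have hK₁ : ∀ c, A.IsTransversal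
      (Function.update (fun _ : Fin 3 => A.init) 0 A.target c) := by
    intro c
    by_cases hc : c = 0 <;> simp [hc, isTransversal_init, isTransversal_target]
  have h₁ := steps_stack hK₁ 1 (by simpa using h)
  have hK₂ : ∀ c, A.IsTransversal (Function.update
      (Function.update (fun _ : Fin 3 => A.init) 0 A.target) 1 A.target c) := by
    intro c
    by_cases hc : c = 1
    · simp [hc, isTransversal_target]
    · simpa [hc] using hK₁ c
  have h₂ := steps_stack hK₂ 2 (by simpa using h)
  have := (h₀.2.trans h₁.2).trans h₂.2
  have htarget : Function.update (Function.update
      (Function.update (fun _ : Fin 3 => A.init) 0 A.target) 1 A.target) 2 A.target =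
      fun _ => A.target := by
    funext c
    fin_cases c <;> rfl
  rw [htarget, show ℓ + ℓ + ℓ = 3 * ℓ by ring] at this
  exact this

/-! ### Projecting sequences to the single copies. -/

theorem move_slice {J J' : Finset (Fin (3 * A.n))} (hJ : ∀ c, A.IsTransversal (slice J c))
    (hJ' : ∀ c, A.IsTransversal (slice J' c)) {p q : Fin (3 * A.n)} (h : IsJump J J' p q) :
    ∃ c, A.Move (slice J c) (slice J' c) ∧ ∀ c' ≠ c, slice J' c' = slice J c' := by
  obtain ⟨hp, hq, rfl⟩ := h
  obtain ⟨⟨c, u⟩, rfl⟩ := finProdFinEquiv.surjective p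
  obtain ⟨⟨d, v⟩, rfl⟩ := finProdFinEquiv.surjective q
  have hmem : ∀ c' w, w ∈ slice (insert (finProdFinEquiv (d, v))
      (J.erase (finProdFinEquiv (c, u)))) c' ↔
      (c' = d ∧ w = v) ∨ ¬ (c' = c ∧ w = u) ∧ w ∈ slice J c' := by
    intro c' w
    rw [mem_slice, mem_slice, Finset.mem_insert, Finset.mem_erase, EmbeddingLike.apply_eq_iff_eq,
      Ne, EmbeddingLike.apply_eq_iff_eq, Prod.mk.injEq, Prod.mk.injEq]
  rw [← mem_slice] at hp hq
  -- Some `z` occupies the clique of `u` after the jump. It is the vertex jumped to, since the only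
  -- earlier occupant was `u`, which has left; so the jump stays in copy `c` and in its token set.
  obtain ⟨z, ⟨hz, hzu⟩, -⟩ := (hJ' c).2 (A.part u)
  rw [hmem] at hz
  rcases hz with ⟨rfl, rfl⟩ | ⟨hne, hz⟩
  · refine ⟨c, ⟨(hJ' c).1, u, z, ⟨hp, hq, ?_⟩, hzu.symm⟩, ?_⟩
    · ext w
      rw [hmem]
      simp
    · intro c' hc'
      ext w
      rw [hmem]
      simp [hc']
  · exact (hne ⟨rfl, (hJ c).inj hz hp hzu⟩).elim

theorem slice_triple_init (c : Fin 3) : slice A.triple.init c = A.init := slice_stack _ c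

theorem slice_triple_target (c : Fin 3) : slice A.triple.target c = A.target := slice_stack _ c

theorem steps_slice {m : ℕ} {J : Finset (Fin (3 * A.n))}
    (h : Steps A.triple.Move A.triple.init m J) :
    (∀ c, A.IsTransversal (slice J c)) ∧ J.card = 3 * A.k ∧
      ∃ a : Fin 3 → ℕ, ∑ c, a c = m ∧ ∀ c, Steps A.Move A.init (a c) (slice J c) := by
  induction h with
  | refl =>
    refine ⟨fun c => ?_, A.triple.init_card, fun _ => 0, by simp, fun c => ?_⟩ <;>
      rw [slice_triple_init]
    exacts [isTransversal_init, .refl]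
  | @tail m J J' _ hm ih =>
    obtain ⟨hJ, hcard, a, ha, hs⟩ := ih
    obtain ⟨hi, p, q, hpq⟩ := hm
    have hcard' : J'.card = 3 * A.k := hpq.card_eq.trans hcard
    have hJ' := isTransversal_slice hi hcard'
    obtain ⟨c, hc, hc'⟩ := move_slice hJ hJ' hpq
    -- Each jump is charged to the single copy that it changes.
    refine ⟨hJ', hcard', Function.update a c (a c + 1), ?_, fun c' => ?_⟩
    · rw [Finset.sum_update_of_mem (Finset.mem_univ c), ← ha,
        ← Finset.add_sum_erase _ _ (Finset.mem_univ c), Finset.sdiff_singleton_eq_erase]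
      ring
    · by_cases hcc : c' = c
      · subst hcc
        simpa using (hs c').tail hc
      · simpa [hcc, hc' c' hcc] using hs c'

theorem exists_hasSequence_of_triple {ℓ m : ℕ} (hm : m ≤ 3 * ℓ) (h : A.triple.HasSequence m) :
    ∃ m ≤ ℓ, A.HasSequence m := by
  rw [ISRInstance.hasSequence_iff] at h
  obtain ⟨-, -, a, ha, hs⟩ := steps_slice h
  have hs' : ∀ c, A.HasSequence (a c) := by
    intro c
    have := hs c
    rw [slice_triple_target] at this
    rwa [hasSequence_iff]
  rw [Fin.sum_univ_three] at ha
  -- Three lengths with sum at most `3 * ℓ` cannot all exceed `ℓ`.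
  by_contra! hcon
  have h₀ := mt (hcon (a 0)) (not_not.2 (hs' 0))
  have h₁ := mt (hcon (a 1)) (not_not.2 (hs' 1))
  have h₂ := mt (hcon (a 2)) (not_not.2 (hs' 2))
  omega

end PartitionedISRInstance

/-! ### Positions in the encoding -/

theorem List.finRange_mul (m n : ℕ) :
    List.finRange (m * n) =
      (List.finRange m).flatMap fun i => (List.finRange n).map fun j => finProdFinEquiv (i, j) := by
  rw [← List.ofFn_id, List.ofFn_mul, List.flatMap_def, List.ofFn_eq_map]
  congr 1
  refine List.map_congr_left fun i _ => ?_
  rw [List.ofFn_eq_map]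
  refine List.map_congr_left fun j _ => Fin.ext ?_
  simp [Nat.mul_comm, Nat.add_comm]

theorem List.getElem?_flatMap_finRange {α : Type} {m n : ℕ} (f : Fin m → Fin n → α) (i : Fin m)
    (j : Fin n) :
    ((List.finRange m).flatMap fun i => (List.finRange n).map (f i))[(i : ℕ) * n + j]? =
      some (f i j) := by
  have h : ((List.finRange m).flatMap fun i => (List.finRange n).map (f i)) =
      (List.finRange (m * n)).map fun p =>
        f (finProdFinEquiv.symm p).1 (finProdFinEquiv.symm p).2 := by
    rw [List.finRange_mul, List.map_flatMap]
    simp only [List.map_map, Function.comp_def, Equiv.symm_apply_apply]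
  have hp : (i : ℕ) * n + j = (finProdFinEquiv (i, j) : Fin (m * n)) := by
    simp [Nat.mul_comm, Nat.add_comm]
  rw [h, hp, List.getElem?_map, List.getElem?_eq_getElem (by rw [List.length_finRange]; exact Fin.isLt _),
    List.getElem_finRange]
  simp [-finProdFinEquiv_apply_val, -finProdFinEquiv_symm_apply]

theorem List.length_flatMap_finRange {α : Type} {m n : ℕ} (f : Fin m → Fin n → α) :
    ((List.finRange m).flatMap fun i => (List.finRange n).map (f i)).length = m * n := by
  simp [List.length_flatMap]

theorem List.getElem?_append_append {α : Type} {l p q r : List α} (h : l = p ++ (q ++ r)) {N i j : ℕ}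
    {a : α} (hp : p.length = N) (hj : j = N + i) (hq : q[i]? = some a) : l[j]? = some a := by
  subst h hp hj
  rw [List.getElem?_append_right (Nat.le_add_right ..), Nat.add_sub_cancel_left,
    List.getElem?_append_left (List.getElem?_eq_some_iff.1 hq).1, hq]

namespace PartitionedISRInstance

variable (A : PartitionedISRInstance)

section Encode

open Classical

/-- The part of the encoding that contains the adjacency matrix. -/
noncomputable def adjBits : List Bool :=
  (List.finRange A.n).flatMap fun u => (List.finRange A.n).map fun v => decide (A.G.Adj u v)

/-- The characteristic vector of a vertex set. -/
noncomputable def setBits (I : Finset (Fin A.n)) : List Bool :=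
  (List.finRange A.n).map fun v => decide (v ∈ I)

/-- The membership matrix of the token sets. -/
noncomputable def partBits : List Bool :=
  (List.finRange A.n).flatMap fun v => (List.finRange A.k).map fun i => decide (A.part v = i)

theorem length_adjBits : A.adjBits.length = A.n * A.n := List.length_flatMap_finRange _

theorem length_setBits (I : Finset (Fin A.n)) : (A.setBits I).length = A.n := by simp [setBits]

theorem encode_eq : A.encode = List.replicate A.n true ++ ([false] ++ (List.replicate A.k true ++
    ([false] ++ (A.adjBits ++ (A.setBits A.init ++ (A.setBits A.target ++ A.partBits)))))) := by
  simp only [encode, ISRInstance.encode, List.append_assoc, setBits, partBits, adjBits]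

theorem setBits_getElem? (I : Finset (Fin A.n)) (v : Fin A.n) :
    (A.setBits I)[(v : ℕ)]? = some (decide (v ∈ I)) := by
  simp [setBits]

/-- The index has the form `0 + j` to fit `exec_scan` with `i = 0`. -/
theorem encode_n {j : ℕ} (hj : j < A.n) : A.encode[0 + j]? = some true :=
  List.getElem?_append_append (p := []) A.encode_eq rfl rfl (by simp [hj])

theorem encode_n_end : A.encode[0 + A.n]? = some false :=
  List.getElem?_append_append (i := 0) A.encode_eq (N := A.n) (by simp) (by simp) rfl

theorem encode_k {j : ℕ} (hj : j < A.k) : A.encode[A.n + 1 + j]? = some true :=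
  List.getElem?_append_append (A.encode_eq.trans (List.append_assoc ..).symm) (N := A.n + 1)
    (by simp) rfl (by simp [hj])

theorem encode_k_end : A.encode[A.n + 1 + A.k]? = some false :=
  List.getElem?_append_append (i := 0)
    (p := List.replicate A.n true ++ [false] ++ List.replicate A.k true) (q := [false])
    (by rw [encode_eq]; simp only [List.append_assoc]; rfl) rfl (by simp; omega) rfl

theorem encode_adj (u v : Fin A.n) :
    A.encode[A.n + A.k + 2 + u * A.n + v]? = some (decide (A.G.Adj u v)) :=
  List.getElem?_append_append (i := u * A.n + v)
    (p := List.replicate A.n true ++ [false] ++ List.replicate A.k true ++ [false])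
    (by rw [encode_eq]; simp only [List.append_assoc]; rfl) rfl (by simp; ring)
    (List.getElem?_flatMap_finRange _ u v)

theorem encode_init (v : Fin A.n) :
    A.encode[A.n + A.k + 2 + A.n * A.n + v]? = some (decide (v ∈ A.init)) :=
  List.getElem?_append_append
    (p := List.replicate A.n true ++ [false] ++ List.replicate A.k true ++ [false] ++ A.adjBits)
    (by rw [encode_eq]; simp only [List.append_assoc]; rfl) rfl (by simp [length_adjBits]; ring)
    (A.setBits_getElem? A.init v)

theorem encode_target (v : Fin A.n) :
    A.encode[A.n + A.k + 2 + A.n * A.n + A.n + v]? = some (decide (v ∈ A.target)) :=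
  List.getElem?_append_append
    (p := List.replicate A.n true ++ [false] ++ List.replicate A.k true ++ [false] ++ A.adjBits ++
      A.setBits A.init)
    (by rw [encode_eq]; simp only [List.append_assoc]; rfl) rfl
    (by simp [length_adjBits, length_setBits]; ring)
    (A.setBits_getElem? A.target v)

theorem encode_part (v : Fin A.n) (i : Fin A.k) :
    A.encode[A.n + A.k + 2 + A.n * A.n + A.n + A.n + v * A.k + i]? =
      some (decide (A.part v = i)) :=
  List.getElem?_append_append (r := []) (i := v * A.k + i)
    (p := List.replicate A.n true ++ [false] ++ List.replicate A.k true ++ [false] ++ A.adjBits ++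
      A.setBits A.init ++ A.setBits A.target)
    (by rw [encode_eq]; simp only [List.append_assoc, List.append_nil]; rfl) rfl
    (by simp [length_adjBits, length_setBits]; ring)
    (List.getElem?_flatMap_finRange _ v i)

/-- The two separators account for the surplus. In particular the input has at least two bits, so
its logarithm is positive. -/
theorem n_add_k_lt_length_encode : A.n + A.k + 1 < A.encode.length := by
  rw [encode_eq]
  simp
  omega

/-- The encoding of the three copies in terms of the original instance. -/
theorem encode_triple : A.triple.encode =
    List.replicate (3 * A.n) true ++ [false] ++ List.replicate (3 * A.k) true ++ [false] ++
    ((List.finRange 3).flatMap fun c => (List.finRange A.n).flatMap fun u =>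
      (List.finRange 3).flatMap fun c' => (List.finRange A.n).flatMap fun v =>
        [decide (c = c' ∧ A.cliqueGraph.Adj u v)]) ++
    ((List.finRange 3).flatMap fun _ => (List.finRange A.n).flatMap fun v =>
      [decide (v ∈ A.init)]) ++
    ((List.finRange 3).flatMap fun _ => (List.finRange A.n).flatMap fun v =>
      [decide (v ∈ A.target)]) := by
  have hset : ∀ I : Finset (Fin A.n),
      ((List.finRange (3 * A.n)).map fun v => decide (v ∈ stack fun _ => I)) =
      (List.finRange 3).flatMap fun _ => (List.finRange A.n).flatMap fun v => [decide (v ∈ I)] := by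
    intro I
    simp only [List.finRange_mul, List.map_flatMap, List.map_map, Function.comp_def, mem_stack,
      ← List.map_eq_flatMap]
  have hadj : ((List.finRange (3 * A.n)).flatMap fun p =>
        (List.finRange (3 * A.n)).map fun q => decide (A.tripleGraph.Adj p q)) =
      (List.finRange 3).flatMap fun c => (List.finRange A.n).flatMap fun u =>
      (List.finRange 3).flatMap fun c' => (List.finRange A.n).flatMap fun v =>
        [decide (c = c' ∧ A.cliqueGraph.Adj u v)] := by
    simp only [List.finRange_mul, List.map_flatMap, List.map_map, Function.comp_def,
      ← List.map_eq_flatMap, List.flatMap_assoc, List.flatMap_map, tripleGraph_adj]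
  rw [← hset, ← hset, ← hadj]
  rfl

end Encode

end PartitionedISRInstance

/-! ### The machine that writes three copies of an instance -/

/-- The registers: the sizes `n` and `k`, two vertices, a token set and two auxiliary counters. -/
inductive Reg where
  | n | k | u | v | i | a | b
  deriving DecidableEq

instance : Finite Reg :=
  Finite.of_surjective (fun j : Fin 7 => match j with
    | 0 => Reg.n | 1 => .k | 2 => .u | 3 => .v | 4 => .i | 5 => .a | 6 => .b) (by
    rintro (_ | _)
    exacts [⟨0, rfl⟩, ⟨1, rfl⟩, ⟨2, rfl⟩, ⟨3, rfl⟩, ⟨4, rfl⟩, ⟨5, rfl⟩, ⟨6, rfl⟩])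

namespace Frag

/-- Run two fragments one after the other. -/
def andThen {R : Type} (F G : Frag R Bool) : Frag R Bool := F.bind fun _ => G

/-- Run a fragment and append the returned bit to the output. -/
def emitResult {R : Type} (F : Frag R Bool) : Frag R Bool := F.bind emit

/-- Move the input head to the first bit of the adjacency matrix. -/
def seekAdj : Frag Reg Bool :=
  ((((rewind.andThen (anyFor .a .n right)).andThen (anyFor .a .k right)).andThen right).andThen
    right).andThen right

/-- Move the input head to the first bit after the adjacency matrix. -/
def seekInit : Frag Reg Bool := seekAdj.andThen (anyFor .a .n (anyFor .b .n right))

/-- Move the input head to the first bit after the first characteristic vector. -/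
def seekTarget : Frag Reg Bool := seekInit.andThen (anyFor .a .n right)

/-- Move the input head to the first bit of the membership matrix. -/
def seekPart : Frag Reg Bool := seekTarget.andThen (anyFor .a .n right)

/-- Are `u` and `v` adjacent in the given graph? -/
def readAdj : Frag Reg Bool :=
  ((seekAdj.andThen (anyFor .a .u (anyFor .b .n right))).andThen (anyFor .a .v right)).andThen
    readBit

/-- Does `v` belong to the first given set? -/
def readInit : Frag Reg Bool := (seekInit.andThen (anyFor .a .v right)).andThen readBit

/-- Does `v` belong to the second given set? -/
def readTarget : Frag Reg Bool := (seekTarget.andThen (anyFor .a .v right)).andThen readBit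

/-- Does the vertex in the register `r` belong to the token set `i`? -/
def readPart (r : Reg) : Frag Reg Bool :=
  ((seekPart.andThen (anyFor .a r (anyFor .b .k right))).andThen (anyFor .a .i right)).andThen
    readBit

/-- Are `u` and `v` adjacent in the graph in which the token sets are cliques? -/
def readCliqueAdj : Frag Reg Bool :=
  readAdj.bind fun e => if e then ret true else
    (regEq .u .v).bind fun e => if e then ret false else
      anyFor .i .k ((readPart .u).bind fun e => if e then readPart .v else ret false)

/-- Run the fragments `F 0`, `F 1` and `F 2`. -/
def thrice {R : Type} (F : Fin 3 → Frag R Bool) : Frag R Bool :=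
  ((F 0).andThen (F 1)).andThen (F 2)

/-- Write the adjacency matrix of the three copies and the characteristic vectors. -/
def writeInstance : Frag Reg Bool :=
  ((thrice fun c => anyFor .u .n (thrice fun c' => anyFor .v .n
      (if c = c' then emitResult readCliqueAdj else emit false))).andThen
    (thrice fun _ => anyFor .v .n (emitResult readInit))).andThen
  (thrice fun _ => anyFor .v .n (emitResult readTarget))

/-- Count the bits `1` up to the next `0`, writing three bits `1` for each. -/
def scan (r : Reg) : Frag Reg Bool :=
  (loop (readBit.bind fun e => if e then
    (inc r).bind fun _ => (((emit true).andThen (emit true)).andThen (emit true)).bind fun _ =>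
      right.bind fun _ => ret none
    else ret (some false))).bind fun _ => (emit false).andThen right

/-- The whole program. -/
def tripleProgram : Frag Reg Bool :=
  (((putWall.bind fun _ => right).andThen (scan .n)).andThen (scan .k)).andThen writeInstance

/-! ### Correctness and space of the program. -/

variable {x : List Bool} {s L : ℕ} {ρ : Reg → ℕ}

theorem Seeks.andThen {R : Type} {ρ : R → ℕ} {F G : Frag R Bool} {p d : ℕ}
    (hF : Seeks F x s L ρ p) (hG : Moves G x s L ρ d) : Seeks (F.andThen G) x s L ρ (p + d) :=
  hF.bind hG

theorem Yields.andThen {R : Type} {ρ : R → ℕ} {F G : Frag R Bool} {b b' : Bool}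
    {w w' : List Bool} (hF : Yields F x s L ρ b w) (hG : Yields G x s L ρ b' w') :
    Yields (F.andThen G) x s L ρ b' (w ++ w') :=
  hF.bind hG

theorem Yields.emitResult {R : Type} {ρ : R → ℕ} {F : Frag R Bool} {b : Bool} (hs : 0 < s)
    (hF : Yields F x s L ρ b []) : Yields F.emitResult x s L ρ false [b] :=
  hF.bind (yields_emit hs b)

theorem Yields.thrice {R : Type} {ρ : R → ℕ} {F : Fin 3 → Frag R Bool} {w : Fin 3 → List Bool}
    (hF : ∀ c, Yields (F c) x s L ρ false (w c)) :
    Yields (thrice F) x s L ρ false ((List.finRange 3).flatMap w) := by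
  have := ((hF 0).andThen (hF 1)).andThen (hF 2)
  rwa [show w 0 ++ w 1 ++ w 2 = (List.finRange 3).flatMap w by
    simp [List.finRange_succ]] at this

theorem Yields.forEach_fin {R : Type} [DecidableEq R] {ρ : R → ℕ} {c b : R} (hcb : c ≠ b)
    {body : Frag R Bool} (hs : L + 2 ≤ s) (hρ : ∀ r, ρ r < 2 ^ L) (hc : ρ c = 0) {m : ℕ}
    (hm : ρ b = m) {w : Fin m → List Bool}
    (hbody : ∀ i : Fin m, Yields body x s L (Function.update ρ c i) false (w i)) :
    Yields (anyFor c b body) x s L ρ false ((List.finRange m).flatMap w) := by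
  subst hm
  have := Yields.forEach (x := x) (body := body) hcb hs hρ hc
    (w := fun i => if h : i < ρ b then w ⟨i, h⟩ else [])
    (fun i hi => by simpa [hi] using hbody ⟨i, hi⟩)
  rw [← List.map_coe_finRange_eq_range, List.flatMap_map] at this
  simpa using this

theorem Yields.exists_fin {R : Type} [DecidableEq R] {ρ : R → ℕ} {c b : R} (hcb : c ≠ b)
    {body : Frag R Bool} (hs : L + 2 ≤ s) (hρ : ∀ r, ρ r < 2 ^ L) (hc : ρ c = 0) {m : ℕ}
    (hm : ρ b = m) {f : Fin m → Bool}
    (hbody : ∀ i : Fin m, Yields body x s L (Function.update ρ c i) (f i) []) :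
    Yields (anyFor c b body) x s L ρ (decide (∃ i, f i = true)) [] := by
  subst hm
  have := Yields.exists (x := x) (body := body) hcb hs hρ hc
    (f := fun i => if h : i < ρ b then f ⟨i, h⟩ else false)
    (fun i hi => by simpa [hi] using hbody ⟨i, hi⟩)
  convert this using 2
  refine ⟨fun ⟨i, hi⟩ => ⟨i, i.2, by simpa using hi⟩, fun ⟨i, hi, h⟩ => ⟨⟨i, hi⟩, ?_⟩⟩
  simpa [hi] using h

/-- The registers `n` and `k` are set, and the auxiliary counters are zero. -/
structure Ready (A : PartitionedISRInstance) (L : ℕ) (ρ : Reg → ℕ) : Prop where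
  n : ρ .n = A.n
  k : ρ .k = A.k
  a : ρ .a = 0
  b : ρ .b = 0
  lt : ∀ r, ρ r < 2 ^ L

namespace Ready

variable {A : PartitionedISRInstance} (hρ : Ready A L ρ) (hs : L + 2 ≤ s)

include hρ

theorem update {r : Reg} (hr : r = .u ∨ r = .v ∨ r = .i) {m : ℕ} (hm : m < A.n ∨ m < A.k) :
    Ready A L (Function.update ρ r m) := by
  have hm' : m < 2 ^ L := by
    have h₁ := hρ.lt .n
    have h₂ := hρ.lt .k
    rw [hρ.n] at h₁
    rw [hρ.k] at h₂
    omega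
  refine ⟨?_, ?_, ?_, ?_, fun r' => ?_⟩
  · rcases hr with rfl | rfl | rfl <;> simp [hρ.n]
  · rcases hr with rfl | rfl | rfl <;> simp [hρ.k]
  · rcases hr with rfl | rfl | rfl <;> simp [hρ.a]
  · rcases hr with rfl | rfl | rfl <;> simp [hρ.b]
  · by_cases h : r' = r
    · subst h
      simpa using hm'
    · simpa [h] using hρ.lt r'

include hs

theorem moves_reg {r : Reg} (hr : .a ≠ r) : Moves (anyFor .a r right) x s L ρ (ρ r) := by
  simpa using Moves.anyFor (x := x) hr hs hρ.lt hρ.a fun _ _ => moves_right (by omega)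

theorem moves_mul {r r' : Reg} (hr : .a ≠ r) (hr' : .b ≠ r') (hra : r' ≠ .a) :
    Moves (anyFor .a r (anyFor .b r' right)) x s L ρ (ρ r * ρ r') := by
  refine Moves.anyFor hr hs hρ.lt hρ.a fun i hi => ?_
  have := Moves.anyFor (x := x) (s := s) (L := L) (ρ := Function.update ρ .a i) hr' hs
    (fun q => ?_) (by simp [hρ.b]) fun _ _ => moves_right (by omega)
  · simpa [hra] using this
  · by_cases h : q = .a
    · subst h
      simpa using hi.trans (hρ.lt r)
    · simpa [h] using hρ.lt q

theorem seeks_adj : Seeks seekAdj x s L ρ (A.n + A.k + 2 + 1) := by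
  have hs0 : 0 < s := by omega
  have := (((((seeks_rewind (x := x) hs0).andThen (hρ.moves_reg hs (r := .n) (by simp))).andThen
    (hρ.moves_reg hs (r := .k) (by simp))).andThen (moves_right hs0)).andThen
    (moves_right hs0)).andThen (moves_right hs0)
  rwa [hρ.n, hρ.k, Nat.zero_add] at this

theorem seeks_init : Seeks seekInit x s L ρ (A.n + A.k + 2 + A.n * A.n + 1) := by
  have := (hρ.seeks_adj (x := x) hs).andThen
    (hρ.moves_mul hs (r := .n) (r' := .n) (by simp) (by simp) (by simp))
  rwa [hρ.n, Nat.add_right_comm _ 1] at this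

theorem seeks_target : Seeks seekTarget x s L ρ (A.n + A.k + 2 + A.n * A.n + A.n + 1) := by
  have := (hρ.seeks_init (x := x) hs).andThen (hρ.moves_reg hs (r := .n) (by simp))
  rwa [hρ.n, Nat.add_right_comm _ 1] at this

theorem seeks_part : Seeks seekPart x s L ρ (A.n + A.k + 2 + A.n * A.n + A.n + A.n + 1) := by
  have := (hρ.seeks_target (x := x) hs).andThen (hρ.moves_reg hs (r := .n) (by simp))
  rwa [hρ.n, Nat.add_right_comm _ 1] at this

open Classical

theorem yields_readAdj {u v : Fin A.n} (hu : ρ .u = u) (hv : ρ .v = v) :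
    Yields readAdj A.encode s L ρ (decide (A.G.Adj u v)) [] := by
  have := ((hρ.seeks_adj (x := A.encode) hs).andThen
    (hρ.moves_mul hs (r := .u) (r' := .n) (by simp) (by simp) (by simp))).andThen
    (hρ.moves_reg hs (r := .v) (by simp))
  rw [hu, hv, hρ.n, Nat.add_right_comm _ 1, Nat.add_right_comm _ 1] at this
  exact this.yields (by omega) (A.encode_adj u v)

theorem yields_readInit {v : Fin A.n} (hv : ρ .v = v) :
    Yields readInit A.encode s L ρ (decide (v ∈ A.init)) [] := by
  have := (hρ.seeks_init (x := A.encode) hs).andThen (hρ.moves_reg hs (r := .v) (by simp))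
  rw [hv, Nat.add_right_comm _ 1] at this
  exact this.yields (by omega) (A.encode_init v)

theorem yields_readTarget {v : Fin A.n} (hv : ρ .v = v) :
    Yields readTarget A.encode s L ρ (decide (v ∈ A.target)) [] := by
  have := (hρ.seeks_target (x := A.encode) hs).andThen (hρ.moves_reg hs (r := .v) (by simp))
  rw [hv, Nat.add_right_comm _ 1] at this
  exact this.yields (by omega) (A.encode_target v)

theorem yields_readPart {r : Reg} (hr : .a ≠ r) {v : Fin A.n} {i : Fin A.k} (hv : ρ r = v)
    (hi : ρ .i = i) : Yields (readPart r) A.encode s L ρ (decide (A.part v = i)) [] := by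
  have := ((hρ.seeks_part (x := A.encode) hs).andThen
    (hρ.moves_mul hs (r := r) (r' := .k) hr (by simp) (by simp))).andThen
    (hρ.moves_reg hs (r := .i) (by simp))
  rw [hv, hi, hρ.k, Nat.add_right_comm _ 1, Nat.add_right_comm _ 1] at this
  exact this.yields (by omega) (A.encode_part v i)

theorem yields_readCliqueAdj {u v : Fin A.n} (hu : ρ .u = u) (hv : ρ .v = v) (hi : ρ .i = 0) :
    Yields readCliqueAdj A.encode s L ρ (decide (A.cliqueGraph.Adj u v)) [] := by
  have hs0 : 0 < s := by omega
  refine (hρ.yields_readAdj hs hu hv).bind (w := []) ?_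
  by_cases hadj : A.G.Adj u v
  · simpa [hadj, PartitionedISRInstance.cliqueGraph] using yields_ret hs0 true
  have heq : Yields (regEq .u .v) A.encode s L ρ (decide (u = v)) [] := by
    intro h hh
    refine ⟨h, hh, fun out => ?_⟩
    have := exec_regEq (x := A.encode) (ρ := ρ) .u .v hh out hs hρ.lt
    simpa [hu, hv, Fin.val_inj] using this
  simp only [hadj, decide_false, Bool.false_eq_true, if_false]
  refine heq.bind (w := []) ?_
  by_cases huv : u = v
  · simpa [hadj, huv, PartitionedISRInstance.cliqueGraph] using yields_ret hs0 false
  simp only [huv, decide_false, Bool.false_eq_true, if_false]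
  -- For distinct non-adjacent vertices it remains to search for a token set that contains both.
  have := Yields.exists_fin (c := .i) (b := .k) (x := A.encode) (ρ := ρ) (by simp) hs hρ.lt hi hρ.k
    (body := (readPart .u).bind fun e => if e then readPart .v else ret false)
    (f := fun i => decide (A.part u = i ∧ A.part v = i)) (fun i => ?_)
  · have hiff : (∃ i, decide (A.part u = i ∧ A.part v = i) = true) ↔ A.cliqueGraph.Adj u v := by
      simp only [decide_eq_true_eq, PartitionedISRInstance.cliqueGraph, hadj, huv, ne_eq,
        not_false_eq_true, true_and, false_or]
      exact ⟨fun ⟨i, hu, hv⟩ => hu.trans hv.symm, fun h => ⟨_, h, rfl⟩⟩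
    simpa only [hiff] using this
  · have hρ' := hρ.update (r := .i) (by simp) (.inr i.2)
    refine (hρ'.yields_readPart hs (by simp) (v := u) (i := i) (by simp [hu]) (by simp)).bind
      (w := []) ?_
    by_cases hp : A.part u = i
    · simpa [hp] using
        hρ'.yields_readPart hs (r := .v) (by simp) (v := v) (i := i) (by simp [hv]) (by simp)
    · simpa [hp] using yields_ret hs0 false

theorem yields_writeInstance (hu : ρ .u = 0) (hv : ρ .v = 0) (hi : ρ .i = 0) :
    Yields writeInstance A.encode s L ρ false
      (((List.finRange 3).flatMap fun c => (List.finRange A.n).flatMap fun u =>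
        (List.finRange 3).flatMap fun c' => (List.finRange A.n).flatMap fun v =>
          [decide (c = c' ∧ A.cliqueGraph.Adj u v)]) ++
      ((List.finRange 3).flatMap fun _ => (List.finRange A.n).flatMap fun v =>
        [decide (v ∈ A.init)]) ++
      ((List.finRange 3).flatMap fun _ => (List.finRange A.n).flatMap fun v =>
        [decide (v ∈ A.target)])) := by
  have hs0 : 0 < s := by omega
  refine Yields.andThen (Yields.andThen (.thrice fun c => ?_) (.thrice fun _ => ?_))
    (.thrice fun _ => ?_)
  · refine .forEach_fin (by simp) hs hρ.lt hu hρ.n fun u => .thrice fun c' => ?_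
    have hρ₁ := hρ.update (r := .u) (by simp) (.inl u.2)
    refine .forEach_fin (by simp) hs hρ₁.lt (by simp [hv]) hρ₁.n fun v => ?_
    have hρ₂ := hρ₁.update (r := .v) (by simp) (.inl v.2)
    by_cases hc : c = c'
    · simpa [hc] using
        (hρ₂.yields_readCliqueAdj hs (u := u) (v := v) (by simp) (by simp)
          (by simp [hi])).emitResult hs0
    · simpa [hc] using yields_emit hs0 false
  · refine .forEach_fin (by simp) hs hρ.lt hv hρ.n fun v => ?_
    have hρ₁ := hρ.update (r := .v) (by simp) (.inl v.2)
    exact (hρ₁.yields_readInit hs (v := v) (by simp)).emitResult hs0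
  · refine .forEach_fin (by simp) hs hρ.lt hv hρ.n fun v => ?_
    have hρ₁ := hρ.update (r := .v) (by simp) (.inl v.2)
    exact (hρ₁.yields_readTarget hs (v := v) (by simp)).emitResult hs0

end Ready

/-- The number of digits is not known in advance and grows during the count, so the space hypothesis
`hs` covers every `L` that respects the invariant `2 ^ L ≤ 2 * x.length`. -/
theorem exec_scan (r : Reg) {i m : ℕ} (hx : ∀ j < m, x[i + j]? = some true)
    (hx' : x[i + m]? = some false) (hs : ∀ L, 2 ^ L ≤ 2 * x.length → L + 2 ≤ s)
    (hL : 2 ^ L ≤ 2 * x.length) (hρ : ∀ r, ρ r < 2 ^ L) (hr : ρ r = 0) (out : List Bool) :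
    ∃ L', 2 ^ L' ≤ 2 * x.length ∧ (∀ r', Function.update ρ r m r' < 2 ^ L') ∧
      (scan r).Exec x s (conf L ρ (i + 1) out) false
        (conf L' (Function.update ρ r m) (i + 1 + m + 1)
          (out ++ (List.replicate (3 * m) true ++ [false]))) := by
  have hs0 : 0 < s := by have := hs L hL; omega
  have hxl : i + m < x.length := (List.getElem?_eq_some_iff.1 hx').1
  suffices H : ∀ j d, d + j = m → ∀ L, 2 ^ L ≤ 2 * x.length →
      (∀ r', Function.update ρ r d r' < 2 ^ L) → ∀ out,
      ∃ L', 2 ^ L' ≤ 2 * x.length ∧ (∀ r', Function.update ρ r m r' < 2 ^ L') ∧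
        (loop (readBit.bind fun e => if e then
          (inc r).bind fun _ => (((emit true).andThen (emit true)).andThen (emit true)).bind fun _ =>
            right.bind fun _ => ret none
          else ret (some false))).Exec x s (conf L (Function.update ρ r d) (i + d + 1) out) false
          (conf L' (Function.update ρ r m) (i + m + 1) (out ++ List.replicate (3 * j) true)) by
    have hρ' : Function.update ρ r 0 = ρ := by rw [← hr, Function.update_eq_self]
    obtain ⟨L', hL', hlt, hx₁⟩ := H m 0 (by omega) L hL (by rwa [hρ']) out
    rw [hρ'] at hx₁
    refine ⟨L', hL', hlt, exec_bind hx₁ ?_⟩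
    have := exec_bind (G := fun _ => right)
      (exec_emit (x := x) (L := L') (ρ := Function.update ρ r m) hs0 false
      (h := i + m + 1) (by omega) (out ++ List.replicate (3 * m) true))
      (exec_right (x := x) hs0 (by omega) _)
    rw [Nat.add_right_comm i 1 m, ← List.append_assoc]
    exact this
  intro j
  induction j with
  | zero =>
    rintro d hd L hL hlt out
    obtain rfl : d = m := hd
    refine ⟨L, hL, hlt, exec_loop_some (exec_bind (exec_readBit hs0 hx' out) ?_)⟩
    simpa using exec_ret (some false) hs0
      (c := conf L (Function.update ρ r d) (i + d + 1) out) (by simp [conf]; omega)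
  | succ j ih =>
    intro d hd L hL hlt out
    have hhd : i + d + 1 ≤ x.length + 1 := by omega
    obtain ⟨L₁, hL₁⟩ : ∃ L₁, L₁ = if d + 1 = 2 ^ L then L + 1 else L := ⟨_, rfl⟩
    have hLL : L ≤ L₁ := by split_ifs at hL₁ <;> omega
    have hdL : d < 2 ^ L := by simpa using hlt r
    -- A digit is added only if `d + 1 = 2 ^ L`; then `2 ^ (L + 1) = 2 * (d + 1)`, and `d + 1 ≤ m <
    -- x.length`.
    have hle : 2 ^ L₁ ≤ 2 * x.length := by
      split_ifs at hL₁ with h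
      · rw [hL₁, pow_succ, ← h]
        omega
      · rwa [hL₁]
    have hdL₁ : d + 1 < 2 ^ L₁ := by
      split_ifs at hL₁ with h
      · rw [hL₁, pow_succ]
        omega
      · rw [hL₁]
        omega
    obtain ⟨L', hL', hlt', hx₁⟩ := ih (d + 1) (by omega) L₁ hle (fun r' => by
      by_cases h : r' = r
      · subst h
        simpa using hdL₁
      · have := hlt r'
        simp only [Function.update_of_ne h] at this ⊢
        exact this.trans_le (Nat.pow_le_pow_right two_pos hLL))
      (out ++ [true] ++ [true] ++ [true])
    refine ⟨L', hL', hlt', exec_loop_none (exec_bind (exec_readBit hs0 (hx d (by omega)) out) ?_)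
      (c₁ := conf L₁ (Function.update ρ r (d + 1)) (i + (d + 1) + 1)
        (out ++ [true] ++ [true] ++ [true])) ?_⟩
    · have hinc := exec_inc (x := x) (ρ := Function.update ρ r d) (L := L) (L' := L₁) r hhd out
        (hs L hL) hlt (by simpa using hL₁)
      simp only [Function.update_self, Function.update_idem] at hinc
      simp only [if_true]
      exact exec_bind hinc (exec_bind (exec_bind (exec_bind (exec_emit hs0 true hhd _)
        (exec_emit hs0 true hhd _)) (exec_emit hs0 true hhd _))
        (exec_bind (exec_right (x := x) hs0 (by omega) _) (exec_ret none hs0 (by simp [conf]; omega))))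
    · convert hx₁ using 2
      simp [Nat.mul_succ, List.replicate_succ]

theorem exec_tripleProgram (A : PartitionedISRInstance)
    (hs : ∀ L, 2 ^ L ≤ 2 * A.encode.length → L + 2 ≤ s) :
    ∃ c : Conf Reg, tripleProgram.Exec A.encode s ⟨0, fun _ => .blank, 0, []⟩ false c ∧
      c.head < s ∧ c.out = A.triple.encode := by
  have hlen := A.n_add_k_lt_length_encode
  have hL₀ : 2 ^ 0 ≤ 2 * A.encode.length := by omega
  have hs0 : 0 < s := by have := hs 0 hL₀; omega
  -- A tape with no digits represents all registers as `0`.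
  have h₀ : (putWall.bind fun _ => right).Exec A.encode s ⟨0, fun _ => .blank, 0, []⟩ false
      (conf 0 (fun _ : Reg => 0) 1 []) :=
    exec_bind (exec_putWall 0 (by omega) hs0 _ []) (exec_right (x := A.encode) hs0 (by omega) [])
  obtain ⟨L₁, hL₁, hlt₁, h₁⟩ := exec_scan (ρ := fun _ => 0) .n (i := 0)
    (fun j hj => A.encode_n hj) A.encode_n_end hs hL₀ (by simp) rfl []
  rw [Nat.zero_add, Nat.add_comm 1] at h₁
  obtain ⟨L₂, hL₂, hlt₂, h₂⟩ := exec_scan .k (i := A.n + 1)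
    (fun j hj => A.encode_k hj) A.encode_k_end hs hL₁ hlt₁ (by simp)
    ([] ++ (List.replicate (3 * A.n) true ++ [false]))
  have hρ : Ready A L₂ (Function.update (Function.update (fun _ : Reg => 0) .n A.n) .k A.k) :=
    ⟨by simp, by simp, by simp, by simp, hlt₂⟩
  obtain ⟨h, -, h₃⟩ := hρ.yields_writeInstance (hs L₂ hL₂) (by simp) (by simp) (by simp)
    (A.n + 1 + 1 + A.k + 1) (by omega)
  refine ⟨_, exec_bind (exec_bind (exec_bind h₀ h₁) h₂) (h₃ _), hs0, ?_⟩
  simp only [conf, A.encode_triple, List.nil_append, List.append_assoc]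

end Frag

theorem isPLReduction_triple :
    IsPLReduction partitionedTJISR tjISR PartitionedISRInstance.triple := by
  refine ⟨fun A => ⟨fun ⟨ℓ, h⟩ => ⟨_, PartitionedISRInstance.HasSequence.triple h⟩, fun ⟨m, h⟩ => ?_⟩,
    fun k => 3 * k, ?_, fun A => le_rfl, Frag.tripleProgram.toTransducer, 4, fun A => ?_⟩
  -- Only existence matters here, so the crude bound `m ≤ 3 * m` is enough.
  · obtain ⟨ℓ, -, h⟩ := PartitionedISRInstance.exists_hasSequence_of_triple (A := A) (ℓ := m)
      (by omega) h
    exact ⟨ℓ, h⟩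
  · exact (Primrec.nat_mul.comp (Primrec.const 3) Primrec.id).to_comp
  · have hlen := A.n_add_k_lt_length_encode
    have hlog : 1 ≤ Nat.log 2 A.encode.length := Nat.log_pos one_lt_two (by omega)
    -- From `2 ^ L ≤ 2 * N` follows `L + 2 ≤ log N + 3 ≤ 4 * log N`, since `log N ≥ 1`; hence the
    -- constant `4`.
    obtain ⟨c, hc, hcs, hout⟩ := Frag.exec_tripleProgram A
      (s := 4 * (3 * A.k + Nat.log 2 A.encode.length)) (fun L hL => by
        have : L ≤ Nat.log 2 (A.encode.length * 2) :=
          Nat.le_log_of_pow_le one_lt_two (by omega)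
        rw [Nat.log_mul_base one_lt_two (by omega)] at this
        omega)
    have := Frag.toTransducer_outputs hc hcs
    rw [hout] at this
    exact this

theorem mainTheorem5 :
    ∃ f : PartitionedISRInstance → ISRInstance,
      IsPLReduction partitionedTJISR tjISR f ∧
      ∀ (A : PartitionedISRInstance) (ℓ : ℕ),
        (A.HasSequence ℓ → (f A).HasSequence (3 * ℓ)) ∧
        ((∃ m ≤ ℓ, A.HasSequence m) ↔ ∃ m ≤ 3 * ℓ, (f A).HasSequence m) :=
  ⟨PartitionedISRInstance.triple, isPLReduction_triple, fun _ _ =>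
    ⟨fun h => h.triple, fun ⟨m, hm, h⟩ => ⟨3 * m, by omega, h.triple⟩, fun ⟨_, hm, h⟩ =>
      PartitionedISRInstance.exists_hasSequence_of_triple hm h⟩⟩
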